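/- **Setting.** Let $d\ge 1$, let ${\sf Z}$ be a measurable space, let $\ell:\mathbb R^d\times{\sf Z}\to\mathbb R$ be measurable in its second argument, and for each $\theta\in\mathbb R^d$ let $\mathbb T_\theta$ be a Markov kernel on ${\sf Z}$ with stationary distribution $\Pi_\theta$. Put $\mathrm{TV}(\mu,\nu)=\sup_A(\mu(A)-\nu(A))$, the supremum over measurable $A$; $\mathcal L(\theta)=\mathbb E_{Z\sim\Pi_\theta}[\ell(\theta;Z)]$; and, for $\delta>0$, $\mathcal L_\delta(\theta)=\mathbb E_{w}[\mathcal L(\theta+\delta w)]$ with $w$ uniform on the unit ball of $\mathbb R^d$. Assume that there are constants $L_0,L_1,G>0$, $L_2,M\ge 0$ and $\rho\in[0,1)$ such that for all $\theta_1,\theta_2,\theta\in\mathbb R^d$, $z\in{\sf Z}$ and integers $n\ge 0$: 1. $|\ell(\theta_1;z)-\ell(\theta_2;z)|\le L_0\|\theta_1-\theta_2\|$; 2. $|\ell(\theta;z)|\le G$; 3. $\mathrm{TV}(\Pi_{\theta_1},\Pi_{\theta_2})\le L_1\|\theta_1-\theta_2\|$; 4. $\mathrm{TV}(\mathbb T_\theta^{\,n}(z,\cdot),\Pi_\theta)\le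 M\rho^n$; 5. $\mathrm{TV}(\mathbb T_{\theta_1}(z,\cdot),\mathbb T_{\theta_2}(z,\cdot))\le L_2\|\theta_1-\theta_2\|$. **Algorithm (DFO($\lambda$)).** Let $\lambda\in[0,1)$, $\eta_0>0$, $\eta_k=\eta_0(1+k)^{-\alpha}$, $\delta_k=d\,(1+k)^{-\beta}$ with $\alpha=3/4$, $\beta=1/6$, and let $\tau_k\ge 1$ be integers with $\tau_k\ge\frac{\log(1+k)}{\log(1/\max\{\rho,\lambda\})}$ (the right-hand side is $0$ if $\rho=\lambda=0$). Start from an arbitrary, possibly random, pair $(\theta_0,Z_0)$. In epoch $k=0,1,2,\dots$ draw $u_k$ uniformly on the unit sphere of $\mathbb R^d$, independently of the past, and set $\theta_k^{(1)}=\theta_k$, $Z_k^{(0)}=Z_k$. For $m=1,\dots,\tau_k$ draw, conditionally on the past, $Z_k^{(m)}\sim\mathbb T_{\theta_k^{(m)}+\delta_ku_k}(Z_k^{(m-1)},\cdot)$ and set $$\theta_k^{(m+1)}=\theta_k^{(m)}-\eta_k\lambda^{\tau_k-m}\,\frac{d}{\delta_k}\,\ell\big(\theta_k^{(m)}+\delta_ku_k;Z_k^{(m)}\big)\,u_k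 .$$ Finally $\theta_{k+1}=\theta_k^{(\tau_k+1)}$ and $Z_{k+1}=Z_k^{(\tau_k)}$. **Statement ($\epsilon$-stationarity and $\mu$-proximity).** Every $\mathcal L_{\delta_k}$ is differentiable, the random variables $\|\nabla\mathcal L_{\delta_k}(\theta_k)\|^2$ and $|\mathcal L_{\delta_k}(\theta_k)-\mathcal L(\theta_k)|$ are integrable, and there are constants $C_1,C_2>0$, depending only on $d,\eta_0,\lambda,\rho,M,G,L_0,L_1,L_2$, such that for all $\epsilon,\mu>0$ and every integer $T\ge\max\{C_1/\epsilon^4,\;C_2/\mu^6\}$ the following two estimates hold simultaneously: $$\frac1{1+T}\sum_{k=0}^{T}\mathbb E\|\nabla\mathcal L_{\delta_k}(\theta_k)\|^2\le\epsilon,\qquad \frac1{1+T}\sum_{k=0}^{T}\mathbb E\big|\mathcal L_{\delta_k}(\theta_k)-\mathcal L(\theta_k)\big|\le\mu .$$ -/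

import Mathlib

open MeasureTheory ProbabilityTheory
open scoped Gradient

noncomputable section

/-- The parameter space `ℝ^d` with its Euclidean norm. -/
abbrev Param (d : ℕ) : Type := EuclideanSpace ℝ (Fin d)

/-- The total variation distance `sup_A (μ(A) - ν(A))`, the supremum running over the measurable
sets. For probability measures the set of these differences is bounded by `1` and contains `0`. -/
def tvDist {S : Type*} [MeasurableSpace S] (μ ν : Measure S) : ℝ :=
  ⨆ A : {A : Set S // MeasurableSet A}, (μ.real A.1 - ν.real A.1)

/-- The uniform distribution on the unit sphere of `ℝ^d`, as a measure on `ℝ^d`: the normalized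
surface measure. -/
def unifSphere (d : ℕ) : Measure (Param d) :=
  ((volume : Measure (Param d)).toSphere Set.univ)⁻¹ •
    ((volume : Measure (Param d)).toSphere.map Subtype.val)

/-- The performative risk `𝓛(θ) = E_{Z ∼ Π_θ} ℓ(θ; Z)`. -/
def perfRisk {d : ℕ} {S : Type*} [MeasurableSpace S] (loss : Param d → S → ℝ)
    (statDist : Param d → Measure S) (θ : Param d) : ℝ :=
  ∫ z, loss θ z ∂(statDist θ)

/-- The smoothing `F_δ(θ) = E_w F(θ + δ w)`, with `w` uniform on the unit ball. -/
def smoothed {d : ℕ} (F : Param d → ℝ) (δ : ℝ) (θ : Param d) : ℝ :=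
  ⨍ w in Metric.closedBall (0 : Param d) 1, F (θ + δ • w)

/-- Lipschitz loss: `|ℓ(θ₁; z) - ℓ(θ₂; z)| ≤ L₀ ‖θ₁ - θ₂‖`. -/
def LipschitzLoss {d : ℕ} {S : Type*} (L₀ : ℝ) (loss : Param d → S → ℝ) : Prop :=
  ∀ θ₁ θ₂ z, |loss θ₁ z - loss θ₂ z| ≤ L₀ * ‖θ₁ - θ₂‖

/-- Bounded loss: `|ℓ(θ; z)| ≤ G`. -/
def BoundedLoss {d : ℕ} {S : Type*} (G : ℝ) (loss : Param d → S → ℝ) : Prop :=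
  ∀ θ z, |loss θ z| ≤ G

/-- Lipschitz distribution map: `TV(Π_{θ₁}, Π_{θ₂}) ≤ L₁ ‖θ₁ - θ₂‖`. -/
def LipschitzDistMap {d : ℕ} {S : Type*} [MeasurableSpace S] (L₁ : ℝ)
    (statDist : Param d → Measure S) : Prop :=
  ∀ θ₁ θ₂, tvDist (statDist θ₁) (statDist θ₂) ≤ L₁ * ‖θ₁ - θ₂‖

/-- Geometric mixing: `TV(P_θ(Z_n ∈ · | Z_0 = z), Π_θ) ≤ M ρ^n`; the law of `Z_n` given `Z_0 = z`
is the `n`-th power of the kernel `𝕋_θ` at `z`. -/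
def GeometricMixing {d : ℕ} {S : Type*} [MeasurableSpace S] (M ρ : ℝ)
    (ker : Param d → Kernel S S) (statDist : Param d → Measure S) : Prop :=
  ∀ θ (n : ℕ) z, tvDist ((ker θ ^ n) z) (statDist θ) ≤ M * ρ ^ n

/-- Smoothness of the Markov kernel: `TV(𝕋_{θ₁}(z, ·), 𝕋_{θ₂}(z, ·)) ≤ L₂ ‖θ₁ - θ₂‖`. -/
def LipschitzKernel {d : ℕ} {S : Type*} [MeasurableSpace S] (L₂ : ℝ)
    (ker : Param d → Kernel S S) : Prop :=
  ∀ θ₁ θ₂ z, tvDist (ker θ₁ z) (ker θ₂ z) ≤ L₂ * ‖θ₁ - θ₂‖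

/-- The information available in epoch `k` after `m` inner draws, without the direction `u_k`:
the σ-algebra generated by `θ_0`, the directions `u_s` and all samples `Z_s^{(j)}` of the epochs
`s < k`, and the samples `Z_k^{(0)}, …, Z_k^{(m)}`. -/
abbrev history {d : ℕ} {S Ω : Type*} [MeasurableSpace S] (τ : ℕ → ℕ)
    (θ₀ : Ω → Param d) (u : ℕ → Ω → Param d) (Zin : ℕ → ℕ → Ω → S) (k m : ℕ) :
    MeasurableSpace Ω :=
  MeasurableSpace.comap θ₀ inferInstance
    ⊔ (⨆ s, ⨆ _ : s < k, MeasurableSpace.comap (u s) inferInstance)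
    ⊔ (⨆ s, ⨆ _ : s < k, ⨆ j, ⨆ _ : j ≤ τ s, MeasurableSpace.comap (Zin s j) inferInstance)
    ⊔ (⨆ j, ⨆ _ : j ≤ m, MeasurableSpace.comap (Zin k j) inferInstance)

/-- `IsDFORun loss ker lam η δ τ P θ Z u θin Zin`: on the probability space `(Ω, P)`, the random
variables `θ k = θ_k`, `Z k = Z_k`, `u k = u_k`, `θin k m = θ_k^{(m)}` (`1 ≤ m ≤ τ_k + 1`) and
`Zin k m = Z_k^{(m)}` (`0 ≤ m ≤ τ_k`) are generated by the DFO(λ) algorithm with the loss `loss`,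
the controlled Markov kernel `ker`, forgetting factor `lam`, step sizes `η`, query radii `δ` and
epoch lengths `τ`. The initial pair `(θ_0, Z_0)` is arbitrary, possibly random. -/
structure IsDFORun {d : ℕ} {S Ω : Type*} [MeasurableSpace S] [MeasurableSpace Ω]
    (loss : Param d → S → ℝ) (ker : Param d → Kernel S S) (lam : ℝ) (η δ : ℕ → ℝ) (τ : ℕ → ℕ)
    (P : Measure Ω) (θ : ℕ → Ω → Param d) (Z : ℕ → Ω → S) (u : ℕ → Ω → Param d)
    (θin : ℕ → ℕ → Ω → Param d) (Zin : ℕ → ℕ → Ω → S) : Prop where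
  measurable_init : Measurable (θ 0)
  measurable_dir : ∀ k, Measurable (u k)
  measurable_sample : ∀ k m, m ≤ τ k → Measurable (Zin k m)
  /-- `θ_k^{(1)} = θ_k` and `Z_k^{(0)} = Z_k`. -/
  start_param : ∀ k, θin k 1 = θ k
  start_sample : ∀ k, Zin k 0 = Z k
  /-- `u_k` is uniform on the unit sphere and independent of everything drawn before it. -/
  dir_law : ∀ k, P.map (u k) = unifSphere d
  dir_indep : ∀ k, Indep (MeasurableSpace.comap (u k) inferInstance)
    (history τ (θ 0) u Zin k 0) P
  /-- Given everything drawn before it, `Z_k^{(m)}` has the law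
  `𝕋_{θ_k^{(m)} + δ_k u_k}(Z_k^{(m-1)}, ·)`. -/
  sample_law : ∀ k m, 1 ≤ m → m ≤ τ k → ∀ A : Set S, MeasurableSet A →
    P[(Zin k m ⁻¹' A).indicator (fun _ => (1 : ℝ)) |
        history τ (θ 0) u Zin k (m - 1) ⊔ MeasurableSpace.comap (u k) inferInstance]
      =ᵐ[P] fun ω => (ker (θin k m ω + δ k • u k ω) (Zin k (m - 1) ω)).real A
  /-- `θ_k^{(m+1)} = θ_k^{(m)} - η_k λ^{τ_k - m} g_k^{(m)}` with
  `g_k^{(m)} = (d / δ_k) ℓ(θ_k^{(m)} + δ_k u_k; Z_k^{(m)}) u_k`. -/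
  update : ∀ k m, 1 ≤ m → m ≤ τ k → ∀ ω,
    θin k (m + 1) ω = θin k m ω - (η k * lam ^ (τ k - m)) •
      (((d : ℝ) / δ k * loss (θin k m ω + δ k • u k ω) (Zin k m ω)) • u k ω)
  /-- `θ_{k+1} = θ_k^{(τ_k + 1)}` and `Z_{k+1} = Z_k^{(τ_k)}`. -/
  next_param : ∀ k, θ (k + 1) = θin k (τ k + 1)
  next_sample : ∀ k, Z (k + 1) = Zin k (τ k)

/-- The polynomially decaying sequence `c (1 + k)^{-a}`. -/
def polyDecay (c a : ℝ) (k : ℕ) : ℝ := c * (1 + (k : ℝ)) ^ (-a)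

end

/-! The performative risk F is bounded by G and Lipschitz with constant K = L₀ + 2GL₁, but need not
be differentiable. Its ball smoothing F_δ inherits the constant K, so its gradient is bounded by K.
By the divergence theorem on the unit ball, ∇F_δ(θ) is the mean over the unit sphere of (d/δ) F(θ +
δu) u (`hasGradientAt_smoothed`). This makes ∇F_δ Lipschitz with constant dK/δ, and it shows that
the one-point estimate would be unbiased if the loss were replaced by F
(`integral_one_point_estimate`).

The actual samples come from a chain whose parameter moves during the epoch. The forgetting factor
turns these moves into a geometric sum, so the drift is at most c/(1-λ) with c = η_k (d/δ_k) G,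
whatever τ_k is. `abs_integral_loss_sub_perfRisk_le` exchanges the transitions one at a time for
those of the chain frozen at θ_k + δ_k u_k, and then lets the frozen chain mix. The resulting bias
enters the descent inequality `epoch_descent`.

Put x = 1 + k, so that d/δ_k = x^{1/6}. After division by η_k, the drift bias is O(x^{-5/12}), the
mixing bias O(x^{-1/3}) because τ_k r^{τ_k} = O(x^{-1/2}) for r = max{ρ, λ}, and the second-order
term O(x^{-1/4}). The remaining terms are increments of the bounded potential E F_{δ_k}(θ_k) + Kδ_k
with weights 1/η_k. By Abel summation they add up to O(1/η_T) = O(T^{3/4}), so the averaged squared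
gradient is O(T^{-1/4}). Proximity follows from |F_δ - F| ≤ Kδ, whose average is O(T^{-1/6}). -/

/-! ### Total variation and integrals of bounded functions. -/

section TotalVariation

variable {S : Type*} [MeasurableSpace S] {μ ν : Measure S} [IsProbabilityMeasure μ]

theorem measureReal_sub_le_tvDist {A : Set S} (hA : MeasurableSet A) :
    μ.real A - ν.real A ≤ tvDist μ ν := by
  refine le_ciSup (f := fun A : {A : Set S // MeasurableSet A} => μ.real A.1 - ν.real A.1)
    ⟨1, ?_⟩ ⟨A, hA⟩
  rintro _ ⟨B, rfl⟩
  have h1 : μ.real B.1 ≤ 1 := measureReal_le_one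
  have h2 : 0 ≤ ν.real B.1 := measureReal_nonneg
  simp only
  linarith

theorem integrable_of_abs_le {f : S → ℝ} {G : ℝ} (hf : Measurable f) (hG : ∀ z, |f z| ≤ G) :
    Integrable f μ :=
  Integrable.of_bound hf.aestronglyMeasurable G (ae_of_all _ hG)

theorem abs_integral_le_of_abs_le {f : S → ℝ} {G : ℝ} (hG : ∀ z, |f z| ≤ G) :
    |∫ z, f z ∂μ| ≤ G := by
  simpa using norm_integral_le_of_norm_le_const (μ := μ) (f := f) (C := G) (ae_of_all _ hG)

variable [IsProbabilityMeasure ν]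

theorem abs_measureReal_sub_le_tvDist {A : Set S} (hA : MeasurableSet A) :
    |μ.real A - ν.real A| ≤ tvDist μ ν := by
  have h1 := measureReal_sub_le_tvDist (μ := μ) (ν := ν) hA
  have h2 := measureReal_sub_le_tvDist (μ := μ) (ν := ν) hA.compl
  rw [probReal_compl_eq_one_sub hA, probReal_compl_eq_one_sub hA] at h2
  rw [abs_le]
  constructor <;> linarith

/-- Layer cake: f + G takes values in [0, 2G], so its integral is that of the masses of the
superlevel sets over levels in (0, 2G]. At each level the two masses differ by at most the total
variation, and the interval has length 2G. -/
theorem integral_sub_integral_le_tvDist {f : S → ℝ} {G : ℝ} (hf : Measurable f)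
    (hG : ∀ z, |f z| ≤ G) :
    ∫ z, f z ∂μ - ∫ z, f z ∂ν ≤ 2 * G * tvDist μ ν := by
  have key : ∀ (κ : Measure S) [IsProbabilityMeasure κ],
      ∫ z, f z ∂κ = (∫ t in Set.Ioc 0 (2 * G), κ.real {a | t ≤ f a + G}) - G := by
    intro κ _
    have hi : Integrable (fun z => f z + G) κ :=
      (integrable_of_abs_le hf hG).add (integrable_const G)
    rw [← hi.integral_eq_integral_Ioc_meas_le
      (ae_of_all _ fun z => by have := abs_le.1 (hG z); simp only [Pi.zero_apply]; linarith)
      (ae_of_all _ fun z => by have := abs_le.1 (hG z); simp only; linarith),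
      integral_add (integrable_of_abs_le hf hG) (integrable_const G)]
    simp
  have hGn : 0 ≤ G := by
    obtain ⟨z⟩ := μ.nonempty_of_neZero
    exact (abs_nonneg _).trans (hG z)
  have hint : ∀ (κ : Measure S) [IsProbabilityMeasure κ],
      IntegrableOn (fun t => κ.real {a | t ≤ f a + G}) (Set.Ioc 0 (2 * G)) := by
    intro κ _
    -- The mass of a superlevel set decreases with the level, and monotone functions are integrable
    -- on compact intervals.
    refine (AntitoneOn.integrableOn_isCompact (isCompact_Icc (a := 0) (b := 2 * G)) ?_).mono_set
      Set.Ioc_subset_Icc_self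
    intro s _ t _ hst
    exact measureReal_mono fun a ha => hst.trans ha
  rw [key μ, key ν]
  have h : (∫ t in Set.Ioc 0 (2 * G), μ.real {a | t ≤ f a + G})
      - (∫ t in Set.Ioc 0 (2 * G), ν.real {a | t ≤ f a + G})
      ≤ ∫ _ in Set.Ioc 0 (2 * G), tvDist μ ν := by
    rw [← integral_sub (hint μ) (hint ν)]
    refine setIntegral_mono_on ((hint μ).sub (hint ν)) (integrableOn_const measure_Ioc_lt_top.ne)
      measurableSet_Ioc fun t _ => ?_
    exact measureReal_sub_le_tvDist (measurableSet_le measurable_const (hf.add_const G))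
  have h2 : ∫ _ in Set.Ioc 0 (2 * G), tvDist μ ν = 2 * G * tvDist μ ν := by
    simp [hGn]
  linarith

theorem abs_integral_sub_integral_le_tvDist {f : S → ℝ} {G : ℝ} (hf : Measurable f)
    (hG : ∀ z, |f z| ≤ G) :
    |∫ z, f z ∂μ - ∫ z, f z ∂ν| ≤ 2 * G * tvDist μ ν := by
  have h1 := integral_sub_integral_le_tvDist (μ := μ) (ν := ν) hf hG
  have h2 := integral_sub_integral_le_tvDist (μ := μ) (ν := ν) hf.neg
    (G := G) (fun z => by simpa using hG z)
  simp only [Pi.neg_apply, integral_neg] at h2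
  rw [abs_le]
  constructor <;> linarith

end TotalVariation

/-! ### Regularity of the performative risk and joint measurability. -/

section PerformativeRisk

variable {d : ℕ} {S : Type*} [MeasurableSpace S] {loss : Param d → S → ℝ}
  {ker : Param d → Kernel S S} {statDist : Param d → Measure S} {G L₀ L₁ L₂ : ℝ}

theorem abs_perfRisk_le [∀ θ, IsProbabilityMeasure (statDist θ)] (hb : BoundedLoss G loss)
    (θ : Param d) : |perfRisk loss statDist θ| ≤ G :=
  abs_integral_le_of_abs_le (hb θ)

/-- The loss is changed first under a fixed law, at cost L₀, and then the law under a fixed loss, at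
cost 2GL₁. -/
theorem abs_perfRisk_sub_le [∀ θ, IsProbabilityMeasure (statDist θ)]
    (hm : ∀ θ, Measurable (loss θ)) (hG : 0 ≤ G) (hl : LipschitzLoss L₀ loss)
    (hb : BoundedLoss G loss) (hd : LipschitzDistMap L₁ statDist) (θ₁ θ₂ : Param d) :
    |perfRisk loss statDist θ₁ - perfRisk loss statDist θ₂| ≤ (L₀ + 2 * G * L₁) * ‖θ₁ - θ₂‖ := by
  have h1 : |∫ z, loss θ₁ z ∂(statDist θ₁) - ∫ z, loss θ₂ z ∂(statDist θ₁)|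
      ≤ L₀ * ‖θ₁ - θ₂‖ := by
    rw [← integral_sub (integrable_of_abs_le (hm θ₁) (hb θ₁))
      (integrable_of_abs_le (hm θ₂) (hb θ₂))]
    exact abs_integral_le_of_abs_le (hl θ₁ θ₂)
  have h2 := abs_integral_sub_integral_le_tvDist (μ := statDist θ₁) (ν := statDist θ₂)
    (hm θ₂) (hb θ₂)
  have h3 : 2 * G * tvDist (statDist θ₁) (statDist θ₂) ≤ 2 * G * (L₁ * ‖θ₁ - θ₂‖) :=
    mul_le_mul_of_nonneg_left (hd θ₁ θ₂) (by positivity)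
  have h4 := abs_sub_le (∫ z, loss θ₁ z ∂(statDist θ₁)) (∫ z, loss θ₂ z ∂(statDist θ₁))
    (∫ z, loss θ₂ z ∂(statDist θ₂))
  unfold perfRisk
  linarith

theorem continuous_of_abs_sub_le {E : Type*} [SeminormedAddCommGroup E] {f : E → ℝ} {K : ℝ}
    (h : ∀ x y, |f x - f y| ≤ K * ‖x - y‖) : Continuous f := by
  refine (LipschitzWith.of_dist_le_mul (K := K.toNNReal) fun x y => ?_).continuous
  rw [Real.dist_eq, dist_eq_norm]
  exact (h x y).trans (mul_le_mul_of_nonneg_right (Real.le_coe_toNNReal K) (norm_nonneg _))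

theorem measurable_uncurry_loss (hm : ∀ θ, Measurable (loss θ)) (hl : LipschitzLoss L₀ loss) :
    Measurable (Function.uncurry loss) :=
  measurable_uncurry_of_continuous_of_measurable
    (fun z => continuous_of_abs_sub_le fun θ₁ θ₂ => hl θ₁ θ₂ z) hm

/-- The controlled Markov kernel as one kernel in the parameter and the current state. -/
noncomputable def jointKernel (ker : Param d → Kernel S S) [∀ θ, IsMarkovKernel (ker θ)]
    (hk : LipschitzKernel L₂ ker) : Kernel (Param d × S) S where
  toFun p := ker p.1 p.2
  measurable' := by
    refine Measure.measurable_of_measurable_coe _ fun A hA => ?_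
    -- Carathéodory argument: the transition probability of A is continuous in θ by the kernel
    -- Lipschitz bound and measurable in z, hence jointly measurable.
    have h : Measurable (Function.uncurry fun (θ : Param d) z => (ker θ z).real A) :=
      measurable_uncurry_of_continuous_of_measurable
        (fun z => continuous_of_abs_sub_le (K := L₂) fun θ₁ θ₂ =>
          (abs_measureReal_sub_le_tvDist hA).trans (hk θ₁ θ₂ z))
        (fun θ => ((ker θ).measurable_coe hA).ennreal_toReal)
    have h2 : (fun p : Param d × S => ker p.1 p.2 A) = fun p : Param d × S =>
        ENNReal.ofReal (Function.uncurry (fun (θ : Param d) z => (ker θ z).real A) p) := by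
      ext p
      simp [Function.uncurry]
    rw [h2]
    exact h.ennreal_ofReal

theorem jointKernel_apply [∀ θ, IsMarkovKernel (ker θ)] (hk : LipschitzKernel L₂ ker)
    (p : Param d × S) : jointKernel ker hk p = ker p.1 p.2 := rfl

instance [∀ θ, IsMarkovKernel (ker θ)] (hk : LipschitzKernel L₂ ker) :
    IsMarkovKernel (jointKernel ker hk) :=
  ⟨fun p => by rw [jointKernel_apply]; infer_instance⟩

end PerformativeRisk

/-! ### Cones as test functions. -/

section Cone

open Metric Set

variable {E : Type*} [NormedAddCommGroup E]

/-- The cone `w ↦ (R - ‖w‖)⁺`. -/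
noncomputable def cone (R : ℝ) (w : E) : ℝ := max (R - ‖w‖) 0

theorem lipschitzWith_cone (R : ℝ) : LipschitzWith 1 (cone R : E → ℝ) := by
  refine LipschitzWith.of_dist_le_mul fun x y => ?_
  rw [Real.dist_eq, dist_eq_norm, NNReal.coe_one, one_mul]
  refine (abs_max_sub_max_le_abs _ _ _).trans ?_
  rw [sub_sub_sub_cancel_left, abs_sub_comm]
  exact abs_norm_sub_norm_le _ _

theorem abs_cone_sub_cone_le (R R' : ℝ) (w : E) : |cone R w - cone R' w| ≤ |R - R'| := by
  refine (abs_max_sub_max_le_abs _ _ _).trans ?_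
  rw [sub_sub_sub_cancel_right]

/-- This is why cones are used: differentiating in the radius recovers the indicator of the ball,
while each cone is Lipschitz and compactly supported, so integration by parts applies to it. -/
theorem hasDerivAt_cone {R : ℝ} {w : E} (hR : ‖w‖ ≠ R) :
    HasDerivAt (fun R => cone R w) ((ball 0 R).indicator 1 w) R := by
  rcases lt_or_gt_of_ne hR with h | h
  · rw [indicator_of_mem (by simpa using h)]
    refine ((hasDerivAt_id R).sub_const ‖w‖).congr_of_eventuallyEq ?_
    filter_upwards [lt_mem_nhds h] with x hx
    exact max_eq_left (by linarith)
  · rw [indicator_of_notMem (by simpa using h.le)]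
    refine (hasDerivAt_const R (0 : ℝ)).congr_of_eventuallyEq ?_
    filter_upwards [gt_mem_nhds h] with x hx
    exact max_eq_right (by linarith)

theorem hasCompactSupport_cone [ProperSpace E] (R : ℝ) : HasCompactSupport (cone R : E → ℝ) := by
  refine HasCompactSupport.intro (isCompact_closedBall (0 : E) R) fun x hx => ?_
  simp only [mem_closedBall, dist_zero_right, not_le] at hx
  exact max_eq_right (by linarith)

theorem lineDeriv_cone [InnerProductSpace ℝ E] {R : ℝ} {w : E} (h0 : w ≠ 0) (hR : ‖w‖ ≠ R)
    (v : E) :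
    lineDeriv ℝ (cone R) w v = (ball 0 R).indicator (fun w => - (inner ℝ w v / ‖w‖)) w := by
  rcases lt_or_gt_of_ne hR with h | h
  · have hev : (cone R : E → ℝ) =ᶠ[nhds w] fun x => R - ‖x‖ := by
      filter_upwards [(isOpen_lt continuous_norm continuous_const).mem_nhds h] with x hx
      exact max_eq_left (by have : ‖x‖ < R := hx; linarith)
    rw [hev.lineDeriv_eq, indicator_of_mem (by simpa using h)]
    have hd : HasFDerivAt (fun x : E => R - ‖x‖) (-(‖w‖⁻¹ • innerSL ℝ w)) w := by
      have := (hasStrictFDerivAt_norm_sq w).hasFDerivAt.sqrt (by positivity)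
      simp only [Real.sqrt_sq (norm_nonneg _)] at this
      refine (this.const_sub R).congr_fderiv ?_
      ext v
      simp
      field_simp
    rw [hd.hasLineDerivAt v |>.lineDeriv]
    simp
    ring
  · have hev : (cone R : E → ℝ) =ᶠ[nhds w] fun x => 0 := by
      filter_upwards [(isOpen_lt continuous_const continuous_norm).mem_nhds h] with x hx
      exact max_eq_right (by have : R < ‖x‖ := hx; linarith)
    rw [hev.lineDeriv_eq, indicator_of_notMem (by simpa using h.le)]
    simp [lineDeriv]

end Cone

/-! ### Polar coordinates and the divergence theorem for Lipschitz functions. -/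

section SphereFormula

open Metric Set

theorem integral_withDensity_volumeIoiPow (n : ℕ) (f : ℝ → ℝ) :
    ∫ r : Ioi (0 : ℝ), f r ∂(Measure.volumeIoiPow n) = ∫ r in Ioi (0 : ℝ), r ^ n * f r := by
  simp only [Measure.volumeIoiPow, ENNReal.ofReal]
  rw [integral_withDensity_eq_integral_smul,
    integral_subtype_comap measurableSet_Ioi fun a ↦ Real.toNNReal (a ^ n) • f a,
    setIntegral_congr_fun measurableSet_Ioi fun x hx ↦ ?_]
  · simp only [NNReal.smul_def, Real.coe_toNNReal _ (pow_nonneg (le_of_lt hx) _), smul_eq_mul]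
  · exact (measurable_subtype_coe.pow_const _).real_toNNReal

variable {E : Type*} [NormedAddCommGroup E] [InnerProductSpace ℝ E] [FiniteDimensional ℝ E]
  [MeasurableSpace E] [BorelSpace E] {μ : Measure E}
  [μ.IsAddHaarMeasure]

theorem ae_norm_ne (R : ℝ) (hR : R ≠ 0) : ∀ᵐ w : E ∂μ, ‖w‖ ≠ R := by
  have h := Measure.addHaar_sphere_of_ne_zero μ (0 : E) hR
  rw [measure_eq_zero_iff_ae_notMem] at h
  filter_upwards [h] with w hw
  simpa using hw

variable [Nontrivial E]

variable (μ)

theorem integral_eq_integral_toSphere {f : E → ℝ} (hf : Integrable f μ) :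
    ∫ x, f x ∂μ = ∫ r in Ioi (0 : ℝ),
      r ^ (Module.finrank ℝ E - 1) * ∫ u : sphere (0 : E) 1, f (r • (u : E)) ∂μ.toSphere := by
  have hmp := μ.measurePreserving_homeomorphUnitSphereProd
  have hemb : MeasurableEmbedding (homeomorphUnitSphereProd E) :=
    Homeomorph.measurableEmbedding _
  have h0 : MeasurableSet ({(0 : E)}ᶜ) := (measurableSet_singleton _).compl
  have hcomp : ∀ x : ({(0 : E)}ᶜ : Set E),
      f x.1 = (fun p : sphere (0 : E) 1 × Ioi (0 : ℝ) => f ((p.2 : ℝ) • (p.1 : E)))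
        (homeomorphUnitSphereProd E x) := by
    intro x
    have hx : ‖(x : E)‖ ≠ 0 := norm_ne_zero_iff.2 x.2
    simp [smul_smul, hx]
  have hint : Integrable (fun p : sphere (0 : E) 1 × Ioi (0 : ℝ) => f ((p.2 : ℝ) • (p.1 : E)))
      (μ.toSphere.prod (Measure.volumeIoiPow (Module.finrank ℝ E - 1))) := by
    rw [← hmp.integrable_comp_emb hemb]
    have : IntegrableOn f ({(0 : E)}ᶜ) μ := hf.integrableOn
    rw [integrableOn_iff_comap_subtypeVal h0] at this
    exact this.congr (ae_of_all _ hcomp)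
  calc ∫ x, f x ∂μ = ∫ x : ({(0 : E)}ᶜ : Set E), f x.1 ∂(μ.comap (↑)) := by
        rw [integral_subtype_comap h0 f, restrict_compl_singleton]
    _ = ∫ p, f ((p.2 : ℝ) • (p.1 : E))
          ∂(μ.toSphere.prod (Measure.volumeIoiPow (Module.finrank ℝ E - 1))) := by
        rw [← hmp.integral_comp hemb]
        exact integral_congr_ae (ae_of_all _ hcomp)
    _ = ∫ r : Ioi (0 : ℝ), ∫ u : sphere (0 : E) 1, f ((r : ℝ) • (u : E)) ∂μ.toSphere
          ∂(Measure.volumeIoiPow (Module.finrank ℝ E - 1)) := integral_prod_symm _ hint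
    _ = _ := integral_withDensity_volumeIoiPow _
        (fun r => ∫ u : sphere (0 : E) 1, f (r • (u : E)) ∂μ.toSphere)

theorem setIntegral_ball_eq_integral_toSphere {f : E → ℝ} {R : ℝ} (hR : 0 ≤ R)
    (hf : IntegrableOn f (ball 0 R) μ) :
    ∫ x in ball 0 R, f x ∂μ = ∫ r in (0 : ℝ)..R,
      r ^ (Module.finrank ℝ E - 1) * ∫ u : sphere (0 : E) 1, f (r • (u : E)) ∂μ.toSphere := by
  rw [← integral_indicator measurableSet_ball, integral_eq_integral_toSphere μ
    ((integrable_indicator_iff measurableSet_ball).2 hf), intervalIntegral.integral_of_le hR,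
    ← integral_Ioc_eq_integral_Ioo.symm, ← integral_indicator measurableSet_Ioi,
    ← integral_indicator measurableSet_Ioo]
  congr 1
  ext r
  by_cases hr : 0 < r
  · by_cases hrR : r < R
    · rw [indicator_of_mem (show r ∈ Ioi 0 from hr),
        indicator_of_mem (show r ∈ Ioo 0 R from ⟨hr, hrR⟩)]
      congr 2
      ext u
      rw [indicator_of_mem]
      simp [norm_smul, abs_of_pos hr, hrR]
    · rw [indicator_of_mem (show r ∈ Ioi 0 from hr), indicator_of_notMem (by simp [hrR])]
      have : ∀ u : sphere (0 : E) 1, (ball 0 R).indicator f (r • (u : E)) = 0 := fun u =>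
        indicator_of_notMem (by simpa [norm_smul, abs_of_pos hr] using hrR) _
      simp [this]
  · rw [indicator_of_notMem (by simpa using hr), indicator_of_notMem (by simp [hr])]

variable {μ}

/-- Integration by parts moves the derivative onto the cone, whose gradient is minus the unit radial
vector on the ball. In polar coordinates the factor ⟨w, v⟩/‖w‖ depends on the direction only. -/
theorem integral_lineDeriv_mul_cone {g : E → ℝ} {K : NNReal} (hg : LipschitzWith K g) (v : E)
    {R : ℝ} (hR : 0 < R) :
    ∫ w, lineDeriv ℝ g w v * cone R w ∂μ = ∫ r in (0 : ℝ)..R,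
      r ^ (Module.finrank ℝ E - 1) *
        ∫ u : sphere (0 : E) 1, g (r • (u : E)) * inner ℝ (u : E) v ∂μ.toSphere := by
  rw [hg.integral_lineDeriv_mul_eq (lipschitzWith_cone R) (hasCompactSupport_cone R)]
  have h1 : ∫ w, lineDeriv ℝ (cone R) w (-v) * g w ∂μ
      = ∫ w in ball 0 R, g w * (inner ℝ w v / ‖w‖) ∂μ := by
    rw [← integral_indicator measurableSet_ball]
    refine integral_congr_ae ?_
    filter_upwards [ae_norm_ne (μ := μ) R hR.ne', Measure.ae_ne μ 0] with w hw h0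
    rw [lineDeriv_cone h0 hw]
    by_cases hm : w ∈ ball (0 : E) R
    · simp only [indicator_of_mem hm, inner_neg_right, neg_div, neg_neg]
      ring
    · simp [indicator_of_notMem hm]
  rw [h1, setIntegral_ball_eq_integral_toSphere μ hR.le]
  · refine intervalIntegral.integral_congr_ae (ae_of_all _ fun r hr => ?_)
    rw [uIoc_of_le hR.le] at hr
    congr 2
    ext u
    have : ‖(u : E)‖ = 1 := by simp
    have hr0 := hr.1
    rw [norm_smul, this, real_inner_smul_left, Real.norm_of_nonneg hr0.le]
    field_simp
  · have hgi : IntegrableOn g (ball 0 R) μ :=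
      (hg.continuous.continuousOn.integrableOn_compact (isCompact_closedBall (0 : E) R)).mono_set
        ball_subset_closedBall
    refine Integrable.mul_bdd (c := ‖v‖) hgi ?_ (ae_of_all _ fun w => ?_)
    · exact (by fun_prop : Measurable fun w : E => inner ℝ w v / ‖w‖).aestronglyMeasurable
    · rw [norm_div, norm_norm]
      refine div_le_of_le_mul₀ (norm_nonneg _) (norm_nonneg _) ?_
      rw [mul_comm]
      exact norm_inner_le_norm w v

/-- The divergence theorem on the unit ball for a Lipschitz function, in a fixed direction. -/
theorem setIntegral_lineDeriv_eq_integral_sphere {g : E → ℝ} {K : NNReal}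
    (hg : LipschitzWith K g) (v : E) :
    ∫ w in closedBall 0 1, lineDeriv ℝ g w v ∂μ
      = ∫ u : sphere (0 : E) 1, g u * inner ℝ (u : E) v ∂μ.toSphere := by
  -- `integral_lineDeriv_mul_cone` is differentiated in R at R = 1. The cone side gives the integral
  -- over the ball; the other side gives `A 1`, since `A` is continuous.
  set A : ℝ → ℝ := fun r => r ^ (Module.finrank ℝ E - 1) *
        ∫ u : sphere (0 : E) 1, g (r • (u : E)) * inner ℝ (u : E) v ∂μ.toSphere with hA
  have hAc : Continuous A := by
    refine (continuous_pow _).mul ?_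
    have hc : Continuous (Function.uncurry fun (r : ℝ) (u : sphere (0 : E) 1) =>
        g (r • (u : E)) * inner ℝ (u : E) v) := by
      have := hg.continuous
      simp only [Function.uncurry_def]
      fun_prop
    have := continuous_parametric_integral_of_continuous (μ := μ.toSphere) hc isCompact_univ
    simpa using this
  have hd1 : HasDerivAt (fun R => ∫ r in (0 : ℝ)..R, A r) (A 1) 1 :=
    intervalIntegral.integral_hasDerivAt_right (hAc.intervalIntegrable _ _)
      hAc.stronglyMeasurable.stronglyMeasurableAtFilter hAc.continuousAt
  have hmeas : AEStronglyMeasurable (fun w => lineDeriv ℝ g w v) μ :=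
    aestronglyMeasurable_lineDeriv hg.continuous μ
  have hbd : ∀ w, ‖lineDeriv ℝ g w v‖ ≤ K * ‖v‖ := fun w =>
    norm_lineDeriv_le_of_lipschitz ℝ hg
  have hd2 : HasDerivAt (fun R => ∫ w, lineDeriv ℝ g w v * cone R w ∂μ)
      (∫ w, lineDeriv ℝ g w v * (ball (0 : E) 1).indicator 1 w ∂μ) 1 := by
    -- For R in (0, 2) the cones vanish outside the ball of radius 2 and are 1-Lipschitz in R, so a
    -- constant on that ball dominates.
    refine (hasDerivAt_integral_of_dominated_loc_of_lip (s := ball 1 1)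
      (bound := (closedBall (0 : E) 2).indicator fun _ => K * ‖v‖) (ball_mem_nhds _ one_pos)
      ?_ ?_ ?_ ?_ ?_ ?_).2
    · exact Filter.Eventually.of_forall fun R =>
        hmeas.mul (lipschitzWith_cone R).continuous.aestronglyMeasurable
    · exact (((lipschitzWith_cone 1).continuous.integrable_of_hasCompactSupport
        (hasCompactSupport_cone 1)).bdd_mul (c := K * ‖v‖) hmeas (ae_of_all _ hbd))
    · exact hmeas.mul (measurable_one.indicator measurableSet_ball).aestronglyMeasurable
    · refine ae_of_all _ fun w => LipschitzOnWith.of_dist_le_mul fun R hR R' hR' => ?_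
      rw [Real.dist_eq, Real.dist_eq, ← mul_sub, abs_mul, Real.coe_nnabs]
      by_cases hw : w ∈ closedBall (0 : E) 2
      · rw [indicator_of_mem hw, abs_of_nonneg (show 0 ≤ (K : ℝ) * ‖v‖ by positivity)]
        exact mul_le_mul (hbd w) (abs_cone_sub_cone_le _ _ _) (abs_nonneg _) (by positivity)
      · have h0 : ∀ R ∈ ball (1 : ℝ) 1, cone R w = 0 := by
          intro R hR
          simp only [mem_closedBall, dist_zero_right, not_le] at hw
          rw [mem_ball, Real.dist_eq, abs_lt] at hR
          exact max_eq_right (by linarith)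
        simp [h0 R hR, h0 R' hR', indicator_of_notMem hw]
    · exact (integrable_indicator_iff measurableSet_closedBall).2
        (integrableOn_const (isCompact_closedBall _ _).measure_lt_top.ne)
    · filter_upwards [ae_norm_ne (μ := μ) 1 one_ne_zero] with w hw
      exact (hasDerivAt_cone hw).const_mul _
  have heq : (fun R => ∫ w, lineDeriv ℝ g w v * cone R w ∂μ)
      =ᶠ[nhds 1] fun R => ∫ r in (0 : ℝ)..R, A r := by
    filter_upwards [lt_mem_nhds one_pos] with R hR
    exact integral_lineDeriv_mul_cone hg v hR
  have hfin := (hd2.congr_of_eventuallyEq heq.symm).unique hd1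
  have hbb : (closedBall (0 : E) 1 : Set E) =ᵐ[μ] ball (0 : E) 1 := by
    filter_upwards [ae_norm_ne (μ := μ) 1 one_ne_zero] with w hw
    have h : w ∈ closedBall (0 : E) 1 ↔ w ∈ ball (0 : E) 1 := by
      simpa using (Ne.le_iff_lt hw : ‖w‖ ≤ 1 ↔ ‖w‖ < 1)
    exact propext h
  rw [setIntegral_congr_set hbb, ← integral_indicator measurableSet_ball]
  rw [hA] at hfin
  simp only [one_pow, one_mul, one_smul] at hfin
  rw [← hfin]
  congr 1
  ext w
  by_cases hm : w ∈ ball (0 : E) 1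
  · simp [indicator_of_mem hm]
  · simp [indicator_of_notMem hm]

end SphereFormula

/-! ### The uniform law on the sphere. -/

section UniformSphere

open Metric Set

variable {d : ℕ}

theorem toSphere_univ_ne_zero (hd : 1 ≤ d) :
    (volume : Measure (Param d)).toSphere univ ≠ 0 := by
  rw [Measure.toSphere_apply_univ, finrank_euclideanSpace_fin]
  exact mul_ne_zero (by exact_mod_cast (by omega : d ≠ 0)) (measure_ball_pos _ _ one_pos).ne'

theorem isProbabilityMeasure_unifSphere (hd : 1 ≤ d) : IsProbabilityMeasure (unifSphere d) := by
  refine ⟨?_⟩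
  rw [unifSphere, Measure.smul_apply, Measure.map_apply measurable_subtype_coe .univ,
    preimage_univ, smul_eq_mul]
  exact ENNReal.inv_mul_cancel (toSphere_univ_ne_zero hd) (measure_ne_top _ _)

theorem ae_norm_eq_one_unifSphere : ∀ᵐ u ∂(unifSphere d), ‖u‖ = 1 := by
  refine Measure.ae_smul_measure ?_ _
  rw [ae_map_iff measurable_subtype_coe.aemeasurable
    (measurableSet_eq_fun continuous_norm.measurable measurable_const)]
  exact ae_of_all _ fun u => by simp

/-- The surface measure has total mass d times the volume of the unit ball. This is the origin of
the factor d in the gradient estimate. -/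
theorem integral_unifSphere {F : Type*} [NormedAddCommGroup F] [NormedSpace ℝ F]
    (f : Param d → F) :
    ∫ u, f u ∂(unifSphere d) = ((d : ℝ) * volume.real (ball (0 : Param d) 1))⁻¹ •
      ∫ u : sphere (0 : Param d) 1, f u ∂(volume : Measure (Param d)).toSphere := by
  rw [unifSphere, integral_smul_measure,
    (MeasurableEmbedding.subtype_coe isClosed_sphere.measurableSet).integral_map]
  congr 1
  rw [ENNReal.toReal_inv, ← measureReal_def, Measure.toSphere_real_apply_univ,
    finrank_euclideanSpace_fin]

end UniformSphere

/-! ### Smoothing over balls and its gradient. -/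

section Smoothing

open Metric Set

variable {d : ℕ} {F : Param d → ℝ} {K δ : ℝ}

theorem abs_average_sub_average_le {f g : Param d → ℝ} {C : ℝ} (hf : Continuous f)
    (hg : Continuous g) (h : ∀ w ∈ closedBall (0 : Param d) 1, |f w - g w| ≤ C) :
    |(⨍ w in closedBall (0 : Param d) 1, f w) - ⨍ w in closedBall (0 : Param d) 1, g w| ≤ C := by
  have hf' : IntegrableOn f (closedBall (0 : Param d) 1) :=
    hf.continuousOn.integrableOn_compact (isCompact_closedBall _ _)
  have hg' : IntegrableOn g (closedBall (0 : Param d) 1) :=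
    hg.continuousOn.integrableOn_compact (isCompact_closedBall _ _)
  have hv : 0 < volume.real (closedBall (0 : Param d) 1) :=
    ENNReal.toReal_pos (measure_closedBall_pos _ _ one_pos).ne'
      (isCompact_closedBall _ _).measure_lt_top.ne
  rw [setAverage_eq, setAverage_eq, ← smul_sub, ← integral_sub hf' hg', smul_eq_mul, abs_mul,
    abs_of_pos (inv_pos.2 hv), inv_mul_le_iff₀ hv, mul_comm]
  exact norm_setIntegral_le_of_norm_le_const (f := fun w => f w - g w)
    (isCompact_closedBall _ _).measure_lt_top h

theorem smoothed_const (c : ℝ) (θ : Param d) : smoothed (fun _ => c) δ θ = c := by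
  rw [smoothed, setAverage_const (measure_closedBall_pos _ _ one_pos).ne'
    (isCompact_closedBall _ _).measure_lt_top.ne]

theorem abs_smoothed_sub_smoothed_le {F' : Param d → ℝ} (hF : Continuous F) (hF' : Continuous F')
    {δ' C : ℝ} {θ θ' : Param d}
    (h : ∀ w ∈ closedBall (0 : Param d) 1, |F (θ + δ • w) - F' (θ' + δ' • w)| ≤ C) :
    |smoothed F δ θ - smoothed F' δ' θ'| ≤ C :=
  abs_average_sub_average_le (by fun_prop) (by fun_prop) h

theorem abs_smoothed_le (hF : Continuous F) {G : ℝ} (hG : ∀ θ, |F θ| ≤ G) (θ : Param d) :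
    |smoothed F δ θ| ≤ G := by
  have := abs_smoothed_sub_smoothed_le (F' := fun _ => (0 : ℝ)) (δ := δ) (δ' := δ) (θ := θ)
    (θ' := θ) (C := G) hF continuous_const fun w _ => by simpa using hG (θ + δ • w)
  simpa [smoothed_const] using this

variable (hK : 0 ≤ K) (hF : ∀ x y, |F x - F y| ≤ K * ‖x - y‖)
include hF

theorem abs_smoothed_sub_le (θ θ' : Param d) :
    |smoothed F δ θ - smoothed F δ θ'| ≤ K * ‖θ - θ'‖ := by
  have hc := continuous_of_abs_sub_le hF
  refine abs_smoothed_sub_smoothed_le hc hc fun w _ => (hF _ _).trans_eq ?_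
  simp

theorem integrable_sphere_average (hd : 1 ≤ d) (hδ : 0 < δ) (θ : Param d) :
    Integrable (fun u : Param d => ((d : ℝ) / δ * F (θ + δ • u)) • u) (unifSphere d) := by
  have hprob := isProbabilityMeasure_unifSphere hd
  have hc := continuous_of_abs_sub_le hF
  refine Integrable.of_bound (by fun_prop : Continuous fun u : Param d =>
    ((d : ℝ) / δ * F (θ + δ • u)) • u).aestronglyMeasurable
      ((d : ℝ) / δ * (|F θ| + K * δ)) ?_
  filter_upwards [ae_norm_eq_one_unifSphere] with u hu
  rw [norm_smul, hu, mul_one, norm_mul, Real.norm_of_nonneg (by positivity), Real.norm_eq_abs]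
  refine mul_le_mul_of_nonneg_left ?_ (by positivity)
  have h1 := hF (θ + δ • u) θ
  rw [add_sub_cancel_left, norm_smul, hu, Real.norm_of_nonneg hδ.le, mul_one] at h1
  have h2 := abs_sub_abs_le_abs_sub (F (θ + δ • u)) (F θ)
  linarith

include hK

/-- Used with `δ' = 0` to compare with F itself, and between consecutive radii because the objective
changes from one epoch to the next. -/
theorem abs_smoothed_sub_radius_le (δ δ' : ℝ) (θ : Param d) :
    |smoothed F δ θ - smoothed F δ' θ| ≤ K * |δ - δ'| := by
  have hc := continuous_of_abs_sub_le hF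
  refine abs_smoothed_sub_smoothed_le hc hc fun w hw => (hF _ _).trans ?_
  rw [add_sub_add_left_eq_sub, ← sub_smul, norm_smul, Real.norm_eq_abs]
  rw [mem_closedBall, dist_zero_right] at hw
  exact mul_le_mul_of_nonneg_left (mul_le_of_le_one_right (abs_nonneg _) hw) hK

theorem abs_smoothed_sub_self_le (hδ : 0 ≤ δ) (θ : Param d) :
    |smoothed F δ θ - F θ| ≤ K * δ := by
  have h := abs_smoothed_sub_radius_le hK hF δ 0 θ
  have h0 : smoothed F 0 θ = F θ := by simpa [smoothed] using smoothed_const (δ := 0) (F θ) θ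
  rwa [h0, sub_zero, abs_of_nonneg hδ] at h

theorem lipschitzWith_of_abs_sub_le : LipschitzWith K.toNNReal F := by
  refine LipschitzWith.of_dist_le_mul fun x y => ?_
  rw [Real.dist_eq, dist_eq_norm, Real.coe_toNNReal K hK]
  exact hF x y

theorem lipschitzWith_comp_affine (hδ : 0 < δ) (θ : Param d) :
    LipschitzWith (K * δ).toNNReal fun w => F (θ + δ • w) := by
  refine LipschitzWith.of_dist_le_mul fun x y => ?_
  rw [Real.dist_eq, dist_eq_norm, Real.coe_toNNReal _ (by positivity)]
  refine (hF _ _).trans_eq ?_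
  rw [add_sub_add_left_eq_sub, ← smul_sub, norm_smul, Real.norm_of_nonneg hδ.le, mul_assoc]

/-- The gradient of the smoothing over balls is an average over the sphere. -/
theorem hasGradientAt_smoothed (hd : 1 ≤ d) (hδ : 0 < δ) (θ : Param d) :
    HasGradientAt (smoothed F δ)
      (∫ u, ((d : ℝ) / δ * F (θ + δ • u)) • u ∂(unifSphere d)) θ := by
  have : Nonempty (Fin d) := ⟨⟨0, hd⟩⟩
  have hc := continuous_of_abs_sub_le hF
  have hLipg := lipschitzWith_comp_affine hK hF hδ θ
  set B := closedBall (0 : Param d) 1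
  have hBfin : volume B ≠ ⊤ := (isCompact_closedBall _ _).measure_lt_top.ne
  -- Rademacher's theorem for the rescaled function, transported back to F by the inverse affine
  -- map.
  have hdiff : ∀ᵐ w : Param d, DifferentiableAt ℝ F (θ + δ • w) := by
    filter_upwards [hLipg.ae_differentiableAt (μ := volume)] with w hw
    have h1 : F = (fun w => F (θ + δ • w)) ∘ fun x => δ⁻¹ • (x - θ) := by
      ext x
      simp [smul_smul, hδ.ne']
    have h2 : δ⁻¹ • (θ + δ • w - θ) = w := by simp [smul_smul, hδ.ne']
    rw [h1]
    refine DifferentiableAt.comp _ ?_ (by fun_prop)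
    rw [h2]
    exact hw
  have hmain := hasFDerivAt_integral_of_dominated_loc_of_lip (𝕜 := ℝ)
    (μ := volume.restrict B) (F := fun θ' w => F (θ' + δ • w))
    (F' := fun w => fderiv ℝ F (θ + δ • w)) (x₀ := θ) (s := univ) (bound := fun _ => K)
    Filter.univ_mem
    (Filter.Eventually.of_forall fun θ' => (by fun_prop : Continuous fun w =>
      F (θ' + δ • w)).aestronglyMeasurable)
    ((by fun_prop : Continuous fun w => F (θ + δ • w)).continuousOn.integrableOn_compact
      (isCompact_closedBall _ _))
    (((measurable_fderiv ℝ F).comp (by fun_prop : Measurable fun w : Param d =>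
      θ + δ • w)).aestronglyMeasurable)
    (ae_of_all _ fun w => by
      refine LipschitzOnWith.of_dist_le_mul fun x _ y _ => ?_
      rw [Real.dist_eq, dist_eq_norm, Real.coe_nnabs, abs_of_nonneg hK]
      refine (hF _ _).trans_eq ?_
      rw [add_sub_add_right_eq_sub])
    (integrableOn_const hBfin)
    (ae_restrict_of_ae (hdiff.mono fun w hw => by
      have h := hw.hasFDerivAt.comp θ ((hasFDerivAt_id θ).add_const (δ • w))
      simpa [Function.comp_def] using h))
  have hsm : smoothed F δ = fun θ' => (volume.real B)⁻¹ • ∫ w in B, F (θ' + δ • w) := by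
    ext θ'
    rw [smoothed, setAverage_eq]
  rw [hasGradientAt_iff_hasFDerivAt, hsm]
  refine (hmain.2.const_smul (volume.real B)⁻¹).congr_fderiv ?_
  ext v
  -- By the chain rule, differentiating in θ is δ⁻¹ times differentiating in w, and to the latter
  -- the divergence theorem applies.
  have hline : (∫ w in B, fderiv ℝ F (θ + δ • w)) v
      = δ⁻¹ * ∫ w in B, lineDeriv ℝ (fun w => F (θ + δ • w)) w v := by
    rw [ContinuousLinearMap.integral_apply hmain.1, ← integral_const_mul]
    refine integral_congr_ae (ae_restrict_of_ae (hdiff.mono fun w hw => ?_))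
    have h := hw.hasFDerivAt.comp w (((hasFDerivAt_id w).const_smul δ).const_add θ)
    have h2 := (h.hasLineDerivAt v).lineDeriv
    simp only [Function.comp_def, Pi.smul_apply, id_eq] at h2
    beta_reduce
    rw [h2]
    simp
    field_simp
  have hint := integrable_sphere_average hF hd hδ θ
  rw [smul_apply, hline, setIntegral_lineDeriv_eq_integral_sphere hLipg v,
    InnerProductSpace.toDual_apply_apply, real_inner_comm, ← integral_inner hint,
    integral_unifSphere]
  have hvol : volume.real B = volume.real (ball (0 : Param d) 1) := by
    rw [Measure.addHaar_real_closedBall_eq_addHaar_real_ball]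
  have hvpos : volume.real (ball (0 : Param d) 1) ≠ 0 :=
    (ENNReal.toReal_pos (measure_ball_pos _ _ one_pos).ne' measure_ball_lt_top.ne).ne'
  have hd0 : (d : ℝ) ≠ 0 := by exact_mod_cast (by omega : d ≠ 0)
  have hint2 : ∫ u : sphere (0 : Param d) 1,
      inner ℝ v (((d : ℝ) / δ * F (θ + δ • (u : Param d))) • (u : Param d))
        ∂(volume : Measure (Param d)).toSphere
      = (d : ℝ) / δ * ∫ u : sphere (0 : Param d) 1, F (θ + δ • (u : Param d)) *
        inner ℝ (u : Param d) v ∂(volume : Measure (Param d)).toSphere := by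
    rw [← integral_const_mul]
    congr 1
    ext u
    rw [real_inner_smul_right, real_inner_comm, mul_assoc]
  rw [hint2, hvol, smul_eq_mul, smul_eq_mul]
  field_simp

theorem norm_gradient_smoothed_le (hd : 1 ≤ d) (hδ : 0 < δ) (θ : Param d) :
    ‖∇ (smoothed F δ) θ‖ ≤ K := by
  have h := hasGradientAt_smoothed hK hF hd hδ θ
  have h2 := (lipschitzWith_of_abs_sub_le hK (abs_smoothed_sub_le (δ := δ) hF))
  rw [h.gradient]
  have h3 := norm_fderiv_le_of_lipschitz ℝ (x₀ := θ) h2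
  rw [(hasGradientAt_iff_hasFDerivAt.1 h).fderiv, LinearIsometryEquiv.norm_map,
    Real.coe_toNNReal K hK] at h3
  exact h3

/-- The sphere formula contains F but no derivative of F, so Lipschitz continuity of F suffices, at
the price of the factor d/δ. -/
theorem norm_gradient_smoothed_sub_le (hd : 1 ≤ d) (hδ : 0 < δ) (θ θ' : Param d) :
    ‖∇ (smoothed F δ) θ - ∇ (smoothed F δ) θ'‖ ≤ (d : ℝ) / δ * K * ‖θ - θ'‖ := by
  have hprob := isProbabilityMeasure_unifSphere hd
  rw [(hasGradientAt_smoothed hK hF hd hδ θ).gradient,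
    (hasGradientAt_smoothed hK hF hd hδ θ').gradient,
    ← integral_sub (integrable_sphere_average hF hd hδ θ)
      (integrable_sphere_average hF hd hδ θ')]
  have : ∀ᵐ u ∂(unifSphere d), ‖((d : ℝ) / δ * F (θ + δ • u)) • u
      - ((d : ℝ) / δ * F (θ' + δ • u)) • u‖ ≤ (d : ℝ) / δ * K * ‖θ - θ'‖ := by
    filter_upwards [ae_norm_eq_one_unifSphere] with u hu
    rw [← sub_smul, norm_smul, hu, mul_one, ← mul_sub, norm_mul,
      Real.norm_of_nonneg (by positivity), mul_assoc]
    refine mul_le_mul_of_nonneg_left ((hF _ _).trans_eq ?_) (by positivity)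
    rw [add_sub_add_right_eq_sub]
  simpa using norm_integral_le_of_norm_le_const this

theorem lipschitzWith_gradient_smoothed (hd : 1 ≤ d) (hδ : 0 < δ) :
    LipschitzWith ((d : ℝ) / δ * K).toNNReal fun θ => ∇ (smoothed F δ) θ := by
  refine LipschitzWith.of_dist_le_mul fun x y => ?_
  rw [dist_eq_norm, dist_eq_norm, Real.coe_toNNReal _ (by positivity)]
  exact norm_gradient_smoothed_sub_le hK hF hd hδ x y

theorem inner_gradient_smoothed (hd : 1 ≤ d) (hδ : 0 < δ) (θ v : Param d) :
    inner ℝ v (∇ (smoothed F δ) θ)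
      = ∫ u, (d : ℝ) / δ * inner ℝ v u * F (θ + δ • u) ∂(unifSphere d) := by
  rw [(hasGradientAt_smoothed hK hF hd hδ θ).gradient,
    ← integral_inner (integrable_sphere_average hF hd hδ θ)]
  congr 1
  ext u
  rw [real_inner_smul_right]
  ring

/-- The mean value inequality on the ball of radius ‖y - x‖ about x, where the gradient varies by at
most (d/δ)K‖y - x‖. The usual factor 1/2 is given up. -/
theorem smoothed_le_add_inner (hd : 1 ≤ d) (hδ : 0 < δ) (x y : Param d) :
    smoothed F δ y ≤ smoothed F δ x + inner ℝ (∇ (smoothed F δ) x) (y - x)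
      + (d : ℝ) / δ * K * ‖y - x‖ ^ 2 := by
  have hg := hasGradientAt_smoothed hK hF hd hδ
  have hfd : ∀ z, HasFDerivAt (smoothed F δ)
      (InnerProductSpace.toDual ℝ (Param d) (∇ (smoothed F δ) z)) z := fun z =>
    hasGradientAt_iff_hasFDerivAt.1 (hg z).differentiableAt.hasGradientAt
  have h := (convex_closedBall x ‖y - x‖).norm_image_sub_le_of_norm_hasFDerivWithin_le'
    (f := smoothed F δ) (C := (d : ℝ) / δ * K * ‖y - x‖)
    (φ := InnerProductSpace.toDual ℝ (Param d) (∇ (smoothed F δ) x))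
    (fun z _ => (hfd z).hasFDerivWithinAt) (fun z hz => by
      rw [← map_sub, LinearIsometryEquiv.norm_map]
      refine (norm_gradient_smoothed_sub_le hK hF hd hδ z x).trans ?_
      rw [mem_closedBall, dist_eq_norm] at hz
      exact mul_le_mul_of_nonneg_left hz (by positivity))
    (mem_closedBall_self (norm_nonneg _)) (y := y) (by simp [dist_eq_norm])
  rw [InnerProductSpace.toDual_apply_apply] at h
  have := (abs_le.1 (Real.norm_eq_abs _ ▸ h)).2
  nlinarith

end Smoothing

/-! ### From conditional probabilities to a joint law. -/

section ConditionalLaw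

variable {Ω E S : Type*} [MeasurableSpace E] [MeasurableSpace S] {m m0 : MeasurableSpace Ω}
  {P : Measure Ω} [IsProbabilityMeasure P] {Y : Ω → E} {Z : Ω → S}

/-- It suffices to test rectangles, by integrating the hypothesis over the events Y ∈ B. Any
m-measurable Y is allowed, so Y may carry coordinates on which κ does not depend. -/
theorem hasCondDistrib_of_condExp_indicator (hm : m ≤ m0) (hY : Measurable[m] Y)
    (hZ : Measurable Z) (κ : Kernel E S) [IsMarkovKernel κ]
    (h : ∀ A, MeasurableSet A → P[(Z ⁻¹' A).indicator (fun _ => (1 : ℝ)) | m]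
      =ᵐ[P] fun ω => (κ (Y ω)).real A) :
    HasCondDistrib Z Y κ P := by
  have hY0 : Measurable Y := hY.mono hm le_rfl
  have := Measure.isProbabilityMeasure_map (μ := P) hY0.aemeasurable
  have := Measure.isProbabilityMeasure_map (μ := P) (hY0.prodMk hZ).aemeasurable
  refine ⟨(hY0.prodMk hZ).aemeasurable, Measure.ext_prod fun {B A} hB hA => ?_⟩
  rw [Measure.map_apply (hY0.prodMk hZ) (hB.prod hA), Measure.compProd_apply_prod hB hA,
    setLIntegral_map hB (κ.measurable_coe hA) hY0]
  have hset : (fun ω => (Y ω, Z ω)) ⁻¹' B ×ˢ A = Y ⁻¹' B ∩ Z ⁻¹' A := rfl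
  have hreal : P.real (Y ⁻¹' B ∩ Z ⁻¹' A) = ∫ ω in Y ⁻¹' B, (κ (Y ω)).real A ∂P := by
    have h1 := setIntegral_condExp hm (μ := P)
      (f := (Z ⁻¹' A).indicator (fun _ => (1 : ℝ))) ((integrable_const 1).indicator (hZ hA))
      (hY hB)
    rw [setIntegral_congr_ae (hm _ (hY hB)) ((h A hA).mono fun ω hω _ => hω)] at h1
    rw [h1, setIntegral_indicator (hZ hA)]
    simp
  have hnn : ∫⁻ ω in Y ⁻¹' B, κ (Y ω) A ∂P
      = ENNReal.ofReal (∫ ω in Y ⁻¹' B, (κ (Y ω)).real A ∂P) := by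
    rw [ofReal_integral_eq_lintegral_ofReal]
    · simp
    · exact Integrable.of_bound
        ((κ.measurable_coe hA).comp hY0).ennreal_toReal.aestronglyMeasurable 1
        (ae_of_all _ fun ω => by
          rw [Real.norm_of_nonneg measureReal_nonneg]
          exact measureReal_le_one)
    · exact ae_of_all _ fun ω => measureReal_nonneg
  rw [hset, hnn, ← hreal, ofReal_measureReal]

theorem integral_comp_prodMk_of_hasCondDistrib {κ : Kernel E S} [IsMarkovKernel κ]
    (h : HasCondDistrib Z Y κ P) (hY : Measurable Y) (hZ : Measurable Z) {F : E × S → ℝ}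
    (hF : Measurable F) (hint : Integrable (fun ω => F (Y ω, Z ω)) P) :
    ∫ ω, F (Y ω, Z ω) ∂P = ∫ ω, ∫ z, F (Y ω, z) ∂(κ (Y ω)) ∂P := by
  have := Measure.isProbabilityMeasure_map (μ := P) hY.aemeasurable
  have hlaw : P.map (fun ω => (Y ω, Z ω)) = (P.map Y) ⊗ₘ κ := h.map_eq
  have hint' : Integrable F ((P.map Y) ⊗ₘ κ) := by
    rw [← hlaw, integrable_map_measure hF.aestronglyMeasurable (hY.prodMk hZ).aemeasurable]
    exact hint
  rw [← integral_map (hY.prodMk hZ).aemeasurable hF.aestronglyMeasurable, hlaw,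
    Measure.integral_compProd hint', integral_map hY.aemeasurable]
  exact (hF.stronglyMeasurable.integral_kernel_prod_right' (κ := κ)).aestronglyMeasurable

end ConditionalLaw

/-! ### The controlled chain against a frozen chain. -/

section ControlledChain

variable {d : ℕ} {S : Type*} [MeasurableSpace S] {loss : Param d → S → ℝ}
  {ker : Param d → Kernel S S} {statDist : Param d → Measure S} {G L₀ L₁ L₂ M ρ : ℝ}

/-- `iterLoss loss ker n x z` is the expected loss at `x` after `n` steps of the chain `𝕋_x`
started at `z`. -/
noncomputable def iterLoss (loss : Param d → S → ℝ) (ker : Param d → Kernel S S) :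
    ℕ → Param d → S → ℝ
  | 0 => loss
  | n + 1 => fun x z => ∫ z', iterLoss loss ker n x z' ∂(ker x z)

instance isMarkovKernel_pow (κ : Kernel S S) [IsMarkovKernel κ] (n : ℕ) :
    IsMarkovKernel (κ ^ n) := by
  induction n with
  | zero => rw [pow_zero]; exact inferInstanceAs (IsMarkovKernel Kernel.id)
  | succ n ih => rw [pow_succ]; exact inferInstanceAs (IsMarkovKernel ((κ ^ n) ∘ₖ κ))

variable [∀ θ, IsMarkovKernel (ker θ)]

theorem abs_iterLoss_le (hb : BoundedLoss G loss) (n : ℕ) (x : Param d) (z : S) :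
    |iterLoss loss ker n x z| ≤ G := by
  induction n generalizing z with
  | zero => exact hb x z
  | succ n ih => exact abs_integral_le_of_abs_le ih

theorem measurable_uncurry_iterLoss (hm : ∀ θ, Measurable (loss θ)) (hl : LipschitzLoss L₀ loss)
    (hk : LipschitzKernel L₂ ker) (n : ℕ) :
    Measurable (Function.uncurry (iterLoss loss ker n)) := by
  induction n with
  | zero => exact measurable_uncurry_loss hm hl
  | succ n ih =>
    have h : StronglyMeasurable fun p : (Param d × S) × S =>
        Function.uncurry (iterLoss loss ker n) (p.1.1, p.2) :=
      (ih.comp (by fun_prop)).stronglyMeasurable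
    exact (h.integral_kernel_prod_right' (κ := jointKernel ker hk)).measurable

theorem measurable_iterLoss (hm : ∀ θ, Measurable (loss θ)) (hl : LipschitzLoss L₀ loss)
    (hk : LipschitzKernel L₂ ker) (n : ℕ) (x : Param d) : Measurable (iterLoss loss ker n x) :=
  (measurable_uncurry_iterLoss hm hl hk n).comp measurable_prodMk_left

theorem iterLoss_eq_integral_pow (hm : ∀ θ, Measurable (loss θ)) (hb : BoundedLoss G loss)
    (n : ℕ) (x : Param d) (z : S) :
    iterLoss loss ker n x z = ∫ z', loss x z' ∂((ker x ^ n) z) := by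
  induction n generalizing z with
  | zero =>
    have : (ker x ^ 0) z = Measure.dirac z := by
      rw [pow_zero]
      exact Kernel.id_apply z
    rw [this, integral_dirac' _ _ (hm x).stronglyMeasurable]
    rfl
  | succ n ih =>
    have hpow : (ker x ^ (n + 1)) z = ((ker x ^ n) ∘ₖ ker x) z := by
      rw [pow_succ]
      rfl
    rw [hpow, Kernel.integral_comp (integrable_of_abs_le (hm x) (hb x))]
    simp only [iterLoss, ih]

theorem abs_iterLoss_sub_perfRisk_le [∀ θ, IsProbabilityMeasure (statDist θ)] (hG : 0 ≤ G)
    (hm : ∀ θ, Measurable (loss θ)) (hb : BoundedLoss G loss)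
    (hmix : GeometricMixing M ρ ker statDist) (n : ℕ) (x : Param d) (z : S) :
    |iterLoss loss ker n x z - perfRisk loss statDist x| ≤ 2 * G * (M * ρ ^ n) := by
  rw [iterLoss_eq_integral_pow hm hb]
  exact (abs_integral_sub_integral_le_tvDist (hm x) (hb x)).trans
    (mul_le_mul_of_nonneg_left (hmix x n z) (by positivity))

variable {Ω : Type*} {m m0 : MeasurableSpace Ω} {P : Measure Ω} [IsProbabilityMeasure P]

theorem integrable_weight_mul {W V : Ω → ℝ} {c : ℝ} (hW : Measurable W) (hV : Measurable V)
    (hWc : ∀ᵐ ω ∂P, |W ω| ≤ c) (hVG : ∀ ω, |V ω| ≤ G) :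
    Integrable (fun ω => W ω * V ω) P := by
  refine Integrable.of_bound (hW.mul hV).aestronglyMeasurable (c * G) ?_
  filter_upwards [hWc] with ω hω
  rw [norm_mul]
  exact mul_le_mul hω (hVG ω) (norm_nonneg _) ((abs_nonneg _).trans hω)

theorem abs_integral_weight_mul_sub_le {W V V' : Ω → ℝ} {c D : ℝ} (hW : Measurable W)
    (hV : Measurable V) (hV' : Measurable V') (hVG : ∀ ω, |V ω| ≤ G) (hVG' : ∀ ω, |V' ω| ≤ G)
    (hWc : ∀ᵐ ω ∂P, |W ω| ≤ c) (hD : ∀ᵐ ω ∂P, |V ω - V' ω| ≤ D) :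
    |(∫ ω, W ω * V ω ∂P) - ∫ ω, W ω * V' ω ∂P| ≤ c * D := by
  rw [← integral_sub (integrable_weight_mul hW hV hWc hVG)
    (integrable_weight_mul hW hV' hWc hVG')]
  have h : ∀ᵐ ω ∂P, ‖W ω * V ω - W ω * V' ω‖ ≤ c * D := by
    filter_upwards [hWc, hD] with ω h1 h2
    rw [← mul_sub, norm_mul]
    exact mul_le_mul h1 h2 (norm_nonneg _) ((abs_nonneg _).trans h1)
  simpa using norm_integral_le_of_norm_le_const h

/-- One step of the controlled chain, compared with one step of the chain frozen at `X`. -/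
theorem abs_integral_iterLoss_step_le (hG : 0 ≤ G) (hm : ∀ θ, Measurable (loss θ))
    (hl : LipschitzLoss L₀ loss) (hb : BoundedLoss G loss) (hk : LipschitzKernel L₂ ker)
    (hL₂ : 0 ≤ L₂) (hle : m ≤ m0) {W : Ω → ℝ} {X X' : Ω → Param d} {Z Z' : Ω → S} {c D : ℝ}
    (hW : Measurable[m] W) (hX : Measurable[m] X) (hX' : Measurable[m] X')
    (hZ : Measurable[m] Z) (hZ' : Measurable Z')
    (hlaw : ∀ A, MeasurableSet A → P[(Z' ⁻¹' A).indicator (fun _ => (1 : ℝ)) | m]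
      =ᵐ[P] fun ω => (ker (X' ω) (Z ω)).real A)
    (hWc : ∀ᵐ ω ∂P, |W ω| ≤ c) (hD : ∀ᵐ ω ∂P, ‖X' ω - X ω‖ ≤ D) (n : ℕ) :
    |(∫ ω, W ω * iterLoss loss ker n (X ω) (Z' ω) ∂P)
      - ∫ ω, W ω * iterLoss loss ker (n + 1) (X ω) (Z ω) ∂P| ≤ c * (2 * G * (L₂ * D)) := by
  have hW0 : Measurable W := hW.mono hle le_rfl
  have hX0 : Measurable X := hX.mono hle le_rfl
  have hX0' : Measurable X' := hX'.mono hle le_rfl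
  have hZ0 : Measurable Z := hZ.mono hle le_rfl
  have hf := measurable_uncurry_iterLoss hm hl hk n
  have hf1 := measurable_uncurry_iterLoss hm hl hk (n + 1)
  -- The kernel ignores the pair (X, W). It is carried along in `Y` so that the weight and the
  -- frozen parameter are constants for the inner integral.
  let κ : Kernel ((Param d × S) × (Param d × ℝ)) S :=
    (jointKernel ker hk).comap Prod.fst measurable_fst
  let Y : Ω → (Param d × S) × (Param d × ℝ) := fun ω => ((X' ω, Z ω), (X ω, W ω))
  have hY : Measurable[m] Y := (hX'.prodMk hZ).prodMk (hX.prodMk hW)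
  have hcond : HasCondDistrib Z' Y κ P := hasCondDistrib_of_condExp_indicator hle hY hZ' κ hlaw
  have hF : Measurable fun p : ((Param d × S) × (Param d × ℝ)) × S =>
      p.1.2.2 * Function.uncurry (iterLoss loss ker n) (p.1.2.1, p.2) :=
    (by fun_prop : Measurable fun p : ((Param d × S) × (Param d × ℝ)) × S => p.1.2.2).mul
      (hf.comp (by fun_prop))
  have hVm : Measurable fun ω => iterLoss loss ker n (X ω) (Z' ω) := hf.comp (hX0.prodMk hZ')
  have hstep := integral_comp_prodMk_of_hasCondDistrib hcond (hY.mono hle le_rfl) hZ' hF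
    (integrable_weight_mul hW0 hVm hWc fun ω => abs_iterLoss_le hb n _ _)
  have hstep' : ∫ ω, W ω * iterLoss loss ker n (X ω) (Z' ω) ∂P
      = ∫ ω, W ω * ∫ z, iterLoss loss ker n (X ω) z ∂(ker (X' ω) (Z ω)) ∂P := by
    refine hstep.trans (integral_congr_ae (ae_of_all _ fun ω => ?_))
    exact integral_const_mul _ _
  rw [hstep']
  refine abs_integral_weight_mul_sub_le hW0 ?_ (hf1.comp (hX0.prodMk hZ0))
    (fun ω => abs_integral_le_of_abs_le fun z => abs_iterLoss_le hb n _ _)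
    (fun ω => abs_iterLoss_le hb _ _ _) hWc ?_
  · have h : StronglyMeasurable fun p : ((Param d × S) × (Param d × ℝ)) × S =>
        Function.uncurry (iterLoss loss ker n) (p.1.2.1, p.2) :=
      (hf.comp (by fun_prop)).stronglyMeasurable
    exact (h.integral_kernel_prod_right' (κ := κ)).measurable.comp (hY.mono hle le_rfl)
  · filter_upwards [hD] with ω hω
    refine (abs_integral_sub_integral_le_tvDist (measurable_iterLoss hm hl hk n (X ω))
      (abs_iterLoss_le hb n (X ω))).trans ?_
    have h1 := hk (X' ω) (X ω) (Z ω)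
    have h2 := mul_le_mul_of_nonneg_left hω hL₂
    exact mul_le_mul_of_nonneg_left (h1.trans h2) (by positivity)

/-- Along a controlled chain whose parameters stay close to `X`, the loss at `X` is close in mean
to its stationary expectation. -/
theorem abs_integral_loss_sub_perfRisk_le [∀ θ, IsProbabilityMeasure (statDist θ)] (hG : 0 ≤ G)
    (hm : ∀ θ, Measurable (loss θ)) (hl : LipschitzLoss L₀ loss) (hb : BoundedLoss G loss)
    (hd : LipschitzDistMap L₁ statDist) (hmix : GeometricMixing M ρ ker statDist)
    (hk : LipschitzKernel L₂ ker) (hL₂ : 0 ≤ L₂) (n : ℕ) {ℋ : ℕ → MeasurableSpace Ω}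
    (hle : ∀ i < n, ℋ i ≤ m0) {W : Ω → ℝ} {X : Ω → Param d} {X' : ℕ → Ω → Param d}
    {Z : ℕ → Ω → S} {c : ℝ} {D : ℕ → ℝ} (hW0 : Measurable W) (hX0 : Measurable X)
    (hW : ∀ i < n, Measurable[ℋ i] W) (hX : ∀ i < n, Measurable[ℋ i] X)
    (hX' : ∀ i < n, Measurable[ℋ i] (X' i)) (hZ : ∀ i < n, Measurable[ℋ i] (Z i))
    (hZ0 : ∀ i ≤ n, Measurable (Z i))
    (hlaw : ∀ i < n, ∀ A, MeasurableSet A →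
      P[(Z (i + 1) ⁻¹' A).indicator (fun _ => (1 : ℝ)) | ℋ i]
        =ᵐ[P] fun ω => (ker (X' i ω) (Z i ω)).real A)
    (hWc : ∀ᵐ ω ∂P, |W ω| ≤ c) (hD : ∀ i < n, ∀ᵐ ω ∂P, ‖X' i ω - X ω‖ ≤ D i) :
    |(∫ ω, W ω * loss (X ω) (Z n ω) ∂P) - ∫ ω, W ω * perfRisk loss statDist (X ω) ∂P|
      ≤ c * (2 * G * (L₂ * ∑ i ∈ Finset.range n, D i) + 2 * G * (M * ρ ^ n)) := by
  -- Hybrid argument: in the j-th expression the first j transitions are the real ones and the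
  -- remaining n - j are frozen at X. Passing from j to j + 1 costs one kernel perturbation `D j`.
  -- The case j = n is the real chain; j = 0 runs the frozen chain for n steps, where mixing
  -- applies.
  have hchain : ∀ j ≤ n, |(∫ ω, W ω * iterLoss loss ker (n - j) (X ω) (Z j ω) ∂P)
      - ∫ ω, W ω * iterLoss loss ker n (X ω) (Z 0 ω) ∂P|
      ≤ c * (2 * G * (L₂ * ∑ i ∈ Finset.range j, D i)) := by
    intro j
    induction j with
    | zero => intro _; simp
    | succ j ih =>
      intro hj
      have h1 := ih (by omega)
      have h2 := abs_integral_iterLoss_step_le hG hm hl hb hk hL₂ (hle j hj) (hW j hj) (hX j hj)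
        (hX' j hj) (hZ j hj) (hZ0 (j + 1) hj) (hlaw j hj) hWc (hD j hj) (n - (j + 1))
      rw [show n - (j + 1) + 1 = n - j by omega] at h2
      rw [Finset.sum_range_succ]
      refine (abs_sub_le _ _ _).trans ((add_le_add h2 h1).trans_eq ?_)
      ring
  have h1 := hchain n le_rfl
  rw [Nat.sub_self] at h1
  have hperf : Measurable (perfRisk loss statDist) :=
    (continuous_of_abs_sub_le (abs_perfRisk_sub_le hm hG hl hb hd)).measurable
  have h2 : |(∫ ω, W ω * iterLoss loss ker n (X ω) (Z 0 ω) ∂P)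
      - ∫ ω, W ω * perfRisk loss statDist (X ω) ∂P| ≤ c * (2 * G * (M * ρ ^ n)) :=
    abs_integral_weight_mul_sub_le hW0
      ((measurable_uncurry_iterLoss hm hl hk n).comp (hX0.prodMk (hZ0 0 (Nat.zero_le _))))
      (hperf.comp hX0) (fun ω => abs_iterLoss_le hb _ _ _) (fun ω => abs_perfRisk_le hb _) hWc
      (ae_of_all _ fun ω => abs_iterLoss_sub_perfRisk_le hG hm hb hmix n _ _)
  refine (abs_sub_le _ _ _).trans ((add_le_add h1 h2).trans_eq ?_)
  ring

end ControlledChain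

/-! ### The filtration of the algorithm. -/

section History

variable {d : ℕ} {S Ω : Type*} [MeasurableSpace S] {τ : ℕ → ℕ} {θ₀ : Ω → Param d}
  {u : ℕ → Ω → Param d} {Zin : ℕ → ℕ → Ω → S} {k m : ℕ}

theorem comap_init_le_history :
    MeasurableSpace.comap θ₀ inferInstance ≤ history τ θ₀ u Zin k m :=
  le_sup_of_le_left (le_sup_of_le_left le_sup_left)

theorem comap_dir_le_history {s : ℕ} (hs : s < k) :
    MeasurableSpace.comap (u s) inferInstance ≤ history τ θ₀ u Zin k m :=
  le_sup_of_le_left (le_sup_of_le_left (le_sup_of_le_right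
    (le_iSup₂_of_le (f := fun s (_ : s < k) => MeasurableSpace.comap (u s) inferInstance)
      s hs le_rfl)))

theorem comap_past_sample_le_history {s j : ℕ} (hs : s < k) (hj : j ≤ τ s) :
    MeasurableSpace.comap (Zin s j) inferInstance ≤ history τ θ₀ u Zin k m :=
  le_sup_of_le_left (le_sup_of_le_right (le_iSup_of_le s (le_iSup_of_le hs
    (le_iSup_of_le j (le_iSup_of_le hj le_rfl)))))

theorem comap_sample_le_history {j : ℕ} (hj : j ≤ m) :
    MeasurableSpace.comap (Zin k j) inferInstance ≤ history τ θ₀ u Zin k m :=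
  le_sup_of_le_right (le_iSup_of_le j (le_iSup_of_le hj le_rfl))

theorem history_le {𝓜 : MeasurableSpace Ω} (h0 : MeasurableSpace.comap θ₀ inferInstance ≤ 𝓜)
    (hu : ∀ s < k, MeasurableSpace.comap (u s) inferInstance ≤ 𝓜)
    (hZ : ∀ s < k, ∀ j ≤ τ s, MeasurableSpace.comap (Zin s j) inferInstance ≤ 𝓜)
    (hZk : ∀ j ≤ m, MeasurableSpace.comap (Zin k j) inferInstance ≤ 𝓜) :
    history τ θ₀ u Zin k m ≤ 𝓜 :=
  sup_le (sup_le (sup_le h0 (iSup₂_le hu))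
    (iSup_le fun s => iSup_le fun hs => iSup₂_le (hZ s hs))) (iSup₂_le hZk)

theorem history_mono {m' : ℕ} (h : m ≤ m') :
    history τ θ₀ u Zin k m ≤ history τ θ₀ u Zin k m' :=
  history_le comap_init_le_history (fun _ hs => comap_dir_le_history hs)
    (fun _ hs _ hj => comap_past_sample_le_history hs hj)
    (fun _ hj => comap_sample_le_history (hj.trans h))

theorem history_sup_le_history_succ :
    history τ θ₀ u Zin k (τ k) ⊔ MeasurableSpace.comap (u k) inferInstance
      ≤ history τ θ₀ u Zin (k + 1) 0 :=
  sup_le (history_le comap_init_le_history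
    (fun _ hs => comap_dir_le_history (hs.trans (Nat.lt_succ_self k)))
    (fun _ hs _ hj => comap_past_sample_le_history (hs.trans (Nat.lt_succ_self k)) hj)
    (fun _ hj => comap_past_sample_le_history (Nat.lt_succ_self k) hj))
    (comap_dir_le_history (Nat.lt_succ_self k))

theorem measurable_dir_info :
    Measurable[history τ θ₀ u Zin k m ⊔ MeasurableSpace.comap (u k) inferInstance] (u k) :=
  (comap_measurable (u k)).mono le_sup_right le_rfl

theorem measurable_sample_info {j : ℕ} (hj : j ≤ m) :
    Measurable[history τ θ₀ u Zin k m ⊔ MeasurableSpace.comap (u k) inferInstance] (Zin k j) :=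
  (comap_measurable (Zin k j)).mono ((comap_sample_le_history hj).trans le_sup_left) le_rfl

end History

/-! ### Geometric sums of the forgetting weights. -/

section Geometric

/-- The largest term is the last one, and the others decrease geometrically away from it. Keeping
the factor λ^{τ-n} makes the drift inside an epoch summable in turn. -/
theorem sum_pow_sub_le {lam : ℝ} (h0 : 0 ≤ lam) (h1 : lam < 1) {n τ : ℕ} (hn : n ≤ τ) :
    ∑ i ∈ Finset.range n, lam ^ (τ - (i + 1)) ≤ lam ^ (τ - n) / (1 - lam) := by
  have hpos : 0 < 1 - lam := by linarith
  induction n with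
  | zero => simpa using div_nonneg (pow_nonneg h0 τ) hpos.le
  | succ n ih =>
    rw [Finset.sum_range_succ]
    have h2 := ih (by omega)
    have h3 : lam ^ (τ - n) = lam * lam ^ (τ - (n + 1)) := by
      rw [← pow_succ']
      congr 1
      omega
    rw [h3] at h2
    have h4 : lam * lam ^ (τ - (n + 1)) / (1 - lam) + lam ^ (τ - (n + 1))
        = lam ^ (τ - (n + 1)) / (1 - lam) := by
      field_simp
      ring
    linarith

theorem sum_pow_sub_le_inv {lam : ℝ} (h0 : 0 ≤ lam) (h1 : lam < 1) {n τ : ℕ} (hn : n ≤ τ) :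
    ∑ i ∈ Finset.range n, lam ^ (τ - (i + 1)) ≤ 1 / (1 - lam) :=
  (sum_pow_sub_le h0 h1 hn).trans
    (div_le_div_of_nonneg_right (pow_le_one₀ h0 h1.le) (by linarith))

end Geometric

/-! ### Unbiasedness under an independent uniform direction. -/

section SpherePerturbation

variable {d : ℕ} {F : Param d → ℝ} {K δ B : ℝ} {Ω : Type*} [MeasurableSpace Ω] {P : Measure Ω}
  [IsProbabilityMeasure P] {X U : Ω → Param d}

theorem integral_weighted_sphere_product (hd : 1 ≤ d) (hK : 0 ≤ K)
    (hF : ∀ x y, |F x - F y| ≤ K * ‖x - y‖) (hFB : ∀ x, |F x| ≤ B) (hδ : 0 < δ)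
    (ν : Measure (Param d)) [IsProbabilityMeasure ν] {g : Param d → Param d} (hg : Continuous g)
    (hgK : ∀ x, ‖g x‖ ≤ K) :
    ∫ p, (d : ℝ) / δ * inner ℝ (g p.1) p.2 * F (p.1 + δ • p.2) ∂(ν.prod (unifSphere d))
      = ∫ x, inner ℝ (g x) (∇ (smoothed F δ) x) ∂ν := by
  have hprob := isProbabilityMeasure_unifSphere hd
  have hFc := continuous_of_abs_sub_le hF
  have hH : Continuous fun p : Param d × Param d =>
      (d : ℝ) / δ * inner ℝ (g p.1) p.2 * F (p.1 + δ • p.2) := by fun_prop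
  have hint : Integrable (fun p : Param d × Param d =>
      (d : ℝ) / δ * inner ℝ (g p.1) p.2 * F (p.1 + δ • p.2)) (ν.prod (unifSphere d)) := by
    refine Integrable.of_bound hH.aestronglyMeasurable ((d : ℝ) / δ * K * B) ?_
    have hae : ∀ᵐ p ∂(ν.prod (unifSphere d)), ‖p.2‖ = 1 :=
      Measure.quasiMeasurePreserving_snd.ae ae_norm_eq_one_unifSphere
    filter_upwards [hae] with p hp
    have h1 : ‖inner ℝ (g p.1) p.2‖ ≤ K := by
      refine (norm_inner_le_norm _ _).trans ?_
      rw [hp, mul_one]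
      exact hgK _
    rw [norm_mul, norm_mul, Real.norm_of_nonneg (show 0 ≤ (d : ℝ) / δ by positivity)]
    exact mul_le_mul (mul_le_mul_of_nonneg_left h1 (by positivity)) (hFB _) (norm_nonneg _)
      (by positivity)
  rw [integral_prod _ hint]
  congr 1
  ext x
  exact (inner_gradient_smoothed hK hF hd hδ x (g x)).symm

/-- The one-point gradient estimate is unbiased for the smoothed objective. -/
theorem integral_one_point_estimate (hd : 1 ≤ d) (hK : 0 ≤ K)
    (hF : ∀ x y, |F x - F y| ≤ K * ‖x - y‖) (hFB : ∀ x, |F x| ≤ B) (hδ : 0 < δ)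
    (hX : Measurable X) (hU : Measurable U) (hXU : IndepFun X U P)
    (hlaw : P.map U = unifSphere d) :
    ∫ ω, (d : ℝ) / δ * inner ℝ (∇ (smoothed F δ) (X ω)) (U ω) * F (X ω + δ • U ω) ∂P
      = ∫ ω, ‖∇ (smoothed F δ) (X ω)‖ ^ 2 ∂P := by
  have := Measure.isProbabilityMeasure_map (μ := P) hX.aemeasurable
  have hmap := (indepFun_iff_map_prod_eq_prod_map_map hX.aemeasurable hU.aemeasurable).1 hXU
  rw [hlaw] at hmap
  have hg : Continuous (∇ (smoothed F δ)) :=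
    (lipschitzWith_gradient_smoothed hK hF hd hδ).continuous
  have hFc := continuous_of_abs_sub_le hF
  have h := integral_weighted_sphere_product hd hK hF hFB hδ (P.map X) hg
    (norm_gradient_smoothed_le hK hF hd hδ)
  have hH : Continuous fun p : Param d × Param d =>
      (d : ℝ) / δ * inner ℝ (∇ (smoothed F δ) p.1) p.2 * F (p.1 + δ • p.2) := by fun_prop
  have hN : Continuous fun x => inner ℝ (∇ (smoothed F δ) x) (∇ (smoothed F δ) x) := by fun_prop
  rw [← hmap, integral_map (hX.prodMk hU).aemeasurable hH.aestronglyMeasurable,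
    integral_map hX.aemeasurable hN.aestronglyMeasurable] at h
  simpa only [real_inner_self_eq_norm_sq] using h

end SpherePerturbation

/-! ### Measurability and drift along a run. -/

namespace IsDFORun

variable {d : ℕ} {S Ω : Type*} [MeasurableSpace S] [mΩ : MeasurableSpace Ω]
  {loss : Param d → S → ℝ} {ker : Param d → Kernel S S} {statDist : Param d → Measure S}
  {G L₀ L₁ L₂ M ρ : ℝ} {lam : ℝ} {η δ : ℕ → ℝ} {τ : ℕ → ℕ}
  {P : Measure Ω} {θ : ℕ → Ω → Param d} {Z : ℕ → Ω → S} {u : ℕ → Ω → Param d}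
  {θin : ℕ → ℕ → Ω → Param d} {Zin : ℕ → ℕ → Ω → S}
  (hrun : IsDFORun loss ker lam η δ τ P θ Z u θin Zin)
include hrun

theorem history_le_ambient {k m : ℕ} (hm : m ≤ τ k) : history τ (θ 0) u Zin k m ≤ mΩ :=
  history_le hrun.measurable_init.comap_le (fun s _ => (hrun.measurable_dir s).comap_le)
    (fun s _ j hj => (hrun.measurable_sample s j hj).comap_le)
    (fun j hj => (hrun.measurable_sample k j (hj.trans hm)).comap_le)

theorem info_le_ambient {k m : ℕ} (hm : m ≤ τ k) :
    history τ (θ 0) u Zin k m ⊔ MeasurableSpace.comap (u k) inferInstance ≤ mΩ :=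
  sup_le (hrun.history_le_ambient hm) (hrun.measurable_dir k).comap_le

/-- Note the shift: θ_k^{(m+1)} uses the samples only up to index m, so it is known when Z_k^{(m+1)}
is drawn. Measurability of `θ k` is a hypothesis here because the induction over epochs supplies it.
-/
theorem measurable_inner_of_measurable (hm : ∀ θ, Measurable (loss θ))
    (hl : LipschitzLoss L₀ loss) {k : ℕ} (hθ : Measurable[history τ (θ 0) u Zin k 0] (θ k))
    {m : ℕ} (hmτ : m ≤ τ k) :
    Measurable[history τ (θ 0) u Zin k m ⊔ MeasurableSpace.comap (u k) inferInstance]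
      (θin k (m + 1)) := by
  induction m with
  | zero =>
    rw [zero_add, hrun.start_param]
    exact hθ.mono le_sup_left le_rfl
  | succ m ih =>
    have h1 := (ih (by omega)).mono (sup_le_sup_right (history_mono (Nat.le_succ m)) _) le_rfl
    have hu : Measurable[history τ (θ 0) u Zin k (m + 1)
        ⊔ MeasurableSpace.comap (u k) inferInstance] (u k) := measurable_dir_info
    have hz : Measurable[history τ (θ 0) u Zin k (m + 1)
        ⊔ MeasurableSpace.comap (u k) inferInstance] (Zin k (m + 1)) :=
      measurable_sample_info le_rfl
    have h2 := (measurable_uncurry_loss hm hl).comp ((h1.add (hu.const_smul (δ k))).prodMk hz)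
    have h3 := h1.sub (((h2.const_mul ((d : ℝ) / δ k)).smul hu).const_smul
      (η k * lam ^ (τ k - (m + 1))))
    have h4 : θin k (m + 1 + 1) = _ := funext (hrun.update k (m + 1) (by omega) hmτ)
    rw [h4]
    exact h3

theorem measurable_param_history (hm : ∀ θ, Measurable (loss θ)) (hl : LipschitzLoss L₀ loss)
    (k : ℕ) : Measurable[history τ (θ 0) u Zin k 0] (θ k) := by
  induction k with
  | zero => exact (comap_measurable (θ 0)).mono comap_init_le_history le_rfl
  | succ k ih =>
    rw [hrun.next_param]
    exact (hrun.measurable_inner_of_measurable hm hl ih le_rfl).mono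
      history_sup_le_history_succ le_rfl

theorem measurable_param (hm : ∀ θ, Measurable (loss θ)) (hl : LipschitzLoss L₀ loss) (k : ℕ) :
    Measurable (θ k) :=
  (hrun.measurable_param_history hm hl k).mono (hrun.history_le_ambient (Nat.zero_le _)) le_rfl

theorem measurable_inner (hm : ∀ θ, Measurable (loss θ)) (hl : LipschitzLoss L₀ loss)
    {k m : ℕ} (hmτ : m ≤ τ k) :
    Measurable[history τ (θ 0) u Zin k m ⊔ MeasurableSpace.comap (u k) inferInstance]
      (θin k (m + 1)) :=
  hrun.measurable_inner_of_measurable hm hl (hrun.measurable_param_history hm hl k) hmτ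

theorem ae_norm_dir (k : ℕ) : ∀ᵐ ω ∂P, ‖u k ω‖ = 1 := by
  refine ae_of_ae_map (hrun.measurable_dir k).aemeasurable (p := fun v => ‖v‖ = 1) ?_
  rw [hrun.dir_law]
  exact ae_norm_eq_one_unifSphere

theorem inner_step (k : ℕ) {m : ℕ} (hmτ : m < τ k) (ω : Ω) :
    θin k (m + 1 + 1) ω - θin k (m + 1) ω = -((η k * lam ^ (τ k - (m + 1))) •
      (((d : ℝ) / δ k * loss (θin k (m + 1) ω + δ k • u k ω) (Zin k (m + 1) ω)) • u k ω)) := by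
  rw [hrun.update k (m + 1) (by omega) hmτ ω]
  abel

/-- Every increment is at most η_k (d/δ_k) G times its forgetting weight. The bound does not grow
with the epoch length, so τ_k may be taken large enough for mixing. -/
theorem norm_inner_sub_le (hb : BoundedLoss G loss) (hlam : 0 ≤ lam) (hlam' : lam < 1) {k : ℕ}
    (hη : 0 < η k) (hδ : 0 < δ k) {ω : Ω} (hu : ‖u k ω‖ = 1) {m : ℕ} (hmτ : m ≤ τ k) :
    ‖θin k (m + 1) ω - θ k ω‖ ≤ η k * (d / δ k * G) * (lam ^ (τ k - m) / (1 - lam)) := by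
  have hG : 0 ≤ G := (abs_nonneg _).trans (hb (θ k ω) (Zin k 0 ω))
  have h : ‖θin k (m + 1) ω - θ k ω‖
      ≤ ∑ i ∈ Finset.range m, η k * (d / δ k * G) * lam ^ (τ k - (i + 1)) := by
    have h1 := Finset.sum_range_sub (fun i => θin k (i + 1) ω) m
    rw [zero_add, hrun.start_param] at h1
    rw [← h1]
    refine norm_sum_le_of_le _ fun i hi => ?_
    rw [hrun.inner_step k (by have := Finset.mem_range.1 hi; omega), norm_neg, norm_smul,
      norm_smul, hu, mul_one, norm_mul, norm_mul, norm_pow, Real.norm_of_nonneg hη.le,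
      Real.norm_of_nonneg hlam, Real.norm_of_nonneg (show 0 ≤ (d : ℝ) / δ k by positivity)]
    have h2 : (d : ℝ) / δ k * ‖loss (θin k (i + 1) ω + δ k • u k ω) (Zin k (i + 1) ω)‖
        ≤ d / δ k * G := mul_le_mul_of_nonneg_left (hb _ _) (by positivity)
    calc _ ≤ η k * lam ^ (τ k - (i + 1)) * (d / δ k * G) :=
          mul_le_mul_of_nonneg_left h2 (by positivity)
      _ = _ := by ring
  rw [← Finset.mul_sum] at h
  exact h.trans (mul_le_mul_of_nonneg_left (sum_pow_sub_le hlam hlam' hmτ) (by positivity))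

theorem indepFun_param_dir (hm : ∀ θ, Measurable (loss θ)) (hl : LipschitzLoss L₀ loss) (k : ℕ) :
    IndepFun (θ k) (u k) P := by
  rw [IndepFun_iff_Indep]
  exact (indep_of_indep_of_le_right (hrun.dir_indep k)
    (hrun.measurable_param_history hm hl k).comap_le).symm

end IsDFORun

/-! ### The scalar weight multiplying the loss. -/

section Weight

variable {d : ℕ} {Ω : Type*} {m : MeasurableSpace Ω} {g : Param d → Param d}
  {X U : Ω → Param d}

theorem measurable_const_mul_inner_comp (hg : Continuous g) (hX : Measurable X)
    (hU : Measurable U) (a : ℝ) : Measurable fun ω => a * inner ℝ (g (X ω)) (U ω) :=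
  ((hg.measurable.comp hX).inner hU).const_mul a

theorem abs_const_mul_inner_le {a K : ℝ} (ha : 0 ≤ a) (hg : ∀ x, ‖g x‖ ≤ K) (x : Param d)
    {v : Param d} (hv : ‖v‖ = 1) : |a * inner ℝ (g x) v| ≤ a * K := by
  rw [abs_mul, abs_of_nonneg ha]
  refine mul_le_mul_of_nonneg_left ((abs_real_inner_le_norm _ _).trans ?_) ha
  rw [hv, mul_one]
  exact hg x

end Weight

/-! ### Bias of the gradient estimate and descent over one epoch. -/

namespace IsDFORun

variable {d : ℕ} {S Ω : Type*} [MeasurableSpace S] [mΩ : MeasurableSpace Ω]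
  {loss : Param d → S → ℝ} {ker : Param d → Kernel S S} {statDist : Param d → Measure S}
  {G L₀ L₁ L₂ M ρ : ℝ} {lam : ℝ} {η δ : ℕ → ℝ} {τ : ℕ → ℕ}
  {P : Measure Ω} [IsProbabilityMeasure P]
  {θ : ℕ → Ω → Param d} {Z : ℕ → Ω → S} {u : ℕ → Ω → Param d}
  {θin : ℕ → ℕ → Ω → Param d} {Zin : ℕ → ℕ → Ω → S}

theorem integrable_comp_param (hrun : IsDFORun loss ker lam η δ τ P θ Z u θin Zin)
    (hm : ∀ θ, Measurable (loss θ)) (hl : LipschitzLoss L₀ loss) {f : Param d → ℝ}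
    (hf : Continuous f) {B : ℝ} (hB : ∀ x, |f x| ≤ B) (k : ℕ) :
    Integrable (fun ω => f (θ k ω)) P :=
  Integrable.of_bound (hf.measurable.comp (hrun.measurable_param hm hl k)).aestronglyMeasurable B
    (ae_of_all _ fun _ => hB _)

variable [∀ θ, IsMarkovKernel (ker θ)] [∀ θ, IsProbabilityMeasure (statDist θ)]

/-- The component of the gradient estimate along the true gradient has small bias. -/
theorem abs_integral_inner_estimate_sub_le
    (hrun : IsDFORun loss ker lam η δ τ P θ Z u θin Zin) (hd : 1 ≤ d) (hlam : 0 ≤ lam)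
    (hlam' : lam < 1) (hG : 0 ≤ G) (hL₀ : 0 ≤ L₀) (hL₁ : 0 ≤ L₁) (hL₂ : 0 ≤ L₂)
    (hm : ∀ θ, Measurable (loss θ)) (hl : LipschitzLoss L₀ loss) (hb : BoundedLoss G loss)
    (hdist : LipschitzDistMap L₁ statDist) (hmix : GeometricMixing M ρ ker statDist)
    (hk : LipschitzKernel L₂ ker) {k : ℕ} (hη : 0 < η k) (hδ : 0 < δ k) {K w c : ℝ}
    (hK : K = L₀ + 2 * G * L₁) (hw : w = d / δ k * K) (hc : c = η k * (d / δ k * G)) {m : ℕ}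
    (hmτ : m < τ k) :
    |(∫ ω, (d / δ k * inner ℝ (∇ (smoothed (perfRisk loss statDist) (δ k)) (θ k ω)) (u k ω))
        * loss (θin k (m + 1) ω + δ k • u k ω) (Zin k (m + 1) ω) ∂P)
      - ∫ ω, ‖∇ (smoothed (perfRisk loss statDist) (δ k)) (θ k ω)‖ ^ 2 ∂P|
      ≤ w * (L₀ * (c / (1 - lam))) +
        w * (2 * G * (L₂ * (c / (1 - lam) / (1 - lam))) + 2 * G * (M * ρ ^ (m + 1))) := by
  have hK0 : 0 ≤ K := by rw [hK]; positivity
  have hlam1 : 0 < 1 - lam := by linarith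
  have hc0 : 0 ≤ c := by rw [hc]; positivity
  have hw0 : 0 ≤ w := by rw [hw]; positivity
  have hF : ∀ x y, |perfRisk loss statDist x - perfRisk loss statDist y| ≤ K * ‖x - y‖ :=
    hK ▸ abs_perfRisk_sub_le hm hG hl hb hdist
  have h3 : ∫ ω, d / δ k * inner ℝ (∇ (smoothed (perfRisk loss statDist) (δ k)) (θ k ω)) (u k ω)
      * perfRisk loss statDist (θ k ω + δ k • u k ω) ∂P
      = ∫ ω, ‖∇ (smoothed (perfRisk loss statDist) (δ k)) (θ k ω)‖ ^ 2 ∂P :=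
    integral_one_point_estimate hd hK0 hF (abs_perfRisk_le hb) hδ
      (hrun.measurable_param hm hl k) (hrun.measurable_dir k)
      (hrun.indepFun_param_dir hm hl k) (hrun.dir_law k)
  have hg : Continuous (∇ (smoothed (perfRisk loss statDist) (δ k))) :=
    (lipschitzWith_gradient_smoothed hK0 hF hd hδ).continuous
  have hgK := norm_gradient_smoothed_le hK0 hF hd hδ
  -- From here on, only continuity and the bound K of the gradient matter, besides the unbiasedness
  -- `h3`.
  generalize ∇ (smoothed (perfRisk loss statDist) (δ k)) = g at h3 hg hgK ⊢
  set ℋ : ℕ → MeasurableSpace Ω := fun i =>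
    history τ (θ 0) u Zin k i ⊔ MeasurableSpace.comap (u k) inferInstance with hℋ
  have hle : ∀ i < m + 1, ℋ i ≤ mΩ := fun i hi => hrun.info_le_ambient (by omega)
  have hθ : ∀ i, Measurable[ℋ i] (θ k) := fun i =>
    (hrun.measurable_param_history hm hl k).mono
      ((history_mono (Nat.zero_le i)).trans le_sup_left) le_rfl
  have hu : ∀ i, Measurable[ℋ i] (u k) := fun i => measurable_dir_info
  set W : Ω → ℝ := fun ω => d / δ k * inner ℝ (g (θ k ω)) (u k ω) with hWdef
  set X : Ω → Param d := fun ω => θ k ω + δ k • u k ω with hXdef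
  have hW : ∀ i, Measurable[ℋ i] W := fun i =>
    measurable_const_mul_inner_comp hg (hθ i) (hu i) _
  have hX : ∀ i, Measurable[ℋ i] X := fun i => (hθ i).add ((hu i).const_smul (δ k))
  have hX' : ∀ i < m + 1, Measurable[ℋ i] fun ω => θin k (i + 1) ω + δ k • u k ω := fun i hi =>
    (hrun.measurable_inner hm hl (by omega)).add ((hu i).const_smul (δ k))
  have hW0 : Measurable W := (hW 0).mono (hle 0 (Nat.succ_pos m)) le_rfl
  have hX0 : Measurable X := (hX 0).mono (hle 0 (Nat.succ_pos m)) le_rfl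
  have hXm0 : Measurable fun ω => θin k (m + 1) ω + δ k • u k ω :=
    (hX' m (Nat.lt_succ_self m)).mono (hle m (Nat.lt_succ_self m)) le_rfl
  have hZ0 : Measurable (Zin k (m + 1)) := hrun.measurable_sample k (m + 1) hmτ
  have hWc : ∀ᵐ ω ∂P, |W ω| ≤ w := by
    filter_upwards [hrun.ae_norm_dir k] with ω hω
    rw [hw]
    exact abs_const_mul_inner_le (by positivity) hgK _ hω
  have hdrift : ∀ i < m + 1, ∀ᵐ ω ∂P, ‖(θin k (i + 1) ω + δ k • u k ω) - X ω‖
      ≤ c / (1 - lam) * lam ^ (τ k - (i + 1)) := by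
    intro i hi
    filter_upwards [hrun.ae_norm_dir k] with ω hω
    rw [hXdef, add_sub_add_right_eq_sub]
    refine (hrun.norm_inner_sub_le hb hlam hlam' hη hδ hω (by omega)).trans ?_
    rw [← hc, div_mul_eq_mul_div, ← mul_div_assoc]
    -- One power of λ is given up so that the drift bounds have the exponents of
    -- `sum_pow_sub_le_inv`.
    have : lam ^ (τ k - i) ≤ lam ^ (τ k - (i + 1)) :=
      pow_le_pow_of_le_one hlam hlam'.le (by omega)
    gcongr
  -- The comparison starts at Z_k^{(0)} and runs over m + 1 transitions. The weight and the frozen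
  -- query point are known from the start because `ℋ 0` already contains u_k.
  have h1 := abs_integral_loss_sub_perfRisk_le (statDist := statDist) (P := P) hG hm hl hb hdist
    hmix hk hL₂ (m + 1) hle hW0 hX0 (fun i _ => hW i) (fun i _ => hX i) hX'
    (fun i _ => measurable_sample_info le_rfl)
    (fun i hi => hrun.measurable_sample k i (by omega))
    (fun i hi A hA => hrun.sample_law k (i + 1) (by omega) (by omega) A hA) hWc hdrift
  have hsum : ∑ i ∈ Finset.range (m + 1), c / (1 - lam) * lam ^ (τ k - (i + 1))
      ≤ c / (1 - lam) / (1 - lam) := by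
    rw [← Finset.mul_sum, div_eq_mul_one_div (c / (1 - lam)) (1 - lam)]
    exact mul_le_mul_of_nonneg_left (sum_pow_sub_le_inv hlam hlam' hmτ) (by positivity)
  -- What remains is to move the query point inside the loss from its current value to the frozen
  -- one, which costs L₀ times the drift.
  have h2 : |(∫ ω, W ω * loss (θin k (m + 1) ω + δ k • u k ω) (Zin k (m + 1) ω) ∂P)
      - ∫ ω, W ω * loss (X ω) (Zin k (m + 1) ω) ∂P| ≤ w * (L₀ * (c / (1 - lam))) := by
    have hlm := measurable_uncurry_loss hm hl
    refine abs_integral_weight_mul_sub_le hW0 (hlm.comp (hXm0.prodMk hZ0))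
      (hlm.comp (hX0.prodMk hZ0)) (fun ω => hb _ _) (fun ω => hb _ _) hWc ?_
    filter_upwards [hdrift m (Nat.lt_succ_self m)] with ω hω
    refine (hl _ _ _).trans (mul_le_mul_of_nonneg_left (hω.trans ?_) hL₀)
    exact mul_le_of_le_one_right (by positivity) (pow_le_one₀ hlam hlam'.le)
  rw [← h3]
  refine (abs_sub_le _ _ _).trans (add_le_add h2 (h1.trans ?_))
  gcongr

/-- The descent inequality of one epoch. -/
theorem epoch_descent
    (hrun : IsDFORun loss ker lam η δ τ P θ Z u θin Zin) (hd : 1 ≤ d) (hlam : 0 ≤ lam)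
    (hlam' : lam < 1) (hG : 0 ≤ G) (hL₀ : 0 ≤ L₀) (hL₁ : 0 ≤ L₁) (hL₂ : 0 ≤ L₂)
    (hm : ∀ θ, Measurable (loss θ)) (hl : LipschitzLoss L₀ loss) (hb : BoundedLoss G loss)
    (hdist : LipschitzDistMap L₁ statDist) (hmix : GeometricMixing M ρ ker statDist)
    (hk : LipschitzKernel L₂ ker) {k : ℕ} (hη : 0 < η k) (hδ : 0 < δ k) (hτ : 1 ≤ τ k)
    {K w c : ℝ} (hK : K = L₀ + 2 * G * L₁) (hw : w = d / δ k * K)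
    (hc : c = η k * (d / δ k * G)) :
    η k * ∫ ω, ‖∇ (smoothed (perfRisk loss statDist) (δ k)) (θ k ω)‖ ^ 2 ∂P
      ≤ (∫ ω, smoothed (perfRisk loss statDist) (δ k) (θ k ω) ∂P)
        - (∫ ω, smoothed (perfRisk loss statDist) (δ k) (θ (k + 1) ω) ∂P)
        + η k * (w * (L₀ * (c / (1 - lam)) + 2 * G * (L₂ * (c / (1 - lam) / (1 - lam))))
            * (1 / (1 - lam))
          + w * (2 * G * M) * ∑ m ∈ Finset.range (τ k), lam ^ (τ k - (m + 1)) * ρ ^ (m + 1))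
        + w * (c / (1 - lam)) ^ 2 := by
  have hK0 : 0 ≤ K := by rw [hK]; positivity
  have hlam1 : 0 < 1 - lam := by linarith
  have hc0 : 0 ≤ c := by rw [hc]; positivity
  have hw0 : 0 ≤ w := by rw [hw]; positivity
  have hF : ∀ x y, |perfRisk loss statDist x - perfRisk loss statDist y| ≤ K * ‖x - y‖ :=
    hK ▸ abs_perfRisk_sub_le hm hG hl hb hdist
  have hest := fun m (hmτ : m < τ k) => hrun.abs_integral_inner_estimate_sub_le hd hlam hlam' hG
    hL₀ hL₁ hL₂ hm hl hb hdist hmix hk hη hδ hK hw hc hmτ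
  have hFc : Continuous (perfRisk loss statDist) := continuous_of_abs_sub_le hF
  have hFG : ∀ x, |perfRisk loss statDist x| ≤ G := abs_perfRisk_le hb
  have hg : Continuous (∇ (smoothed (perfRisk loss statDist) (δ k))) :=
    (lipschitzWith_gradient_smoothed hK0 hF hd hδ).continuous
  have hgK := norm_gradient_smoothed_le hK0 hF hd hδ
  have hsi := hrun.integrable_comp_param hm hl (P := P)
    (continuous_of_abs_sub_le (abs_smoothed_sub_le (δ := δ k) hF)) (abs_smoothed_le hFc hFG)
  have hdesc := smoothed_le_add_inner hK0 hF hd hδ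
  generalize ∇ (smoothed (perfRisk loss statDist) (δ k)) = g at hest hg hgK hdesc ⊢
  generalize smoothed (perfRisk loss statDist) (δ k) = Φ at hsi hdesc ⊢
  have hθ0 := hrun.measurable_param hm hl k
  have hu0 := hrun.measurable_dir k
  set V : ℕ → Ω → ℝ := fun m ω => (d / δ k * inner ℝ (g (θ k ω)) (u k ω))
    * loss (θin k (m + 1) ω + δ k • u k ω) (Zin k (m + 1) ω) with hV
  have hVi : ∀ m ∈ Finset.range (τ k), Integrable (V m) P := by
    intro m hmr
    have hmτ := Finset.mem_range.1 hmr
    have hWm := measurable_const_mul_inner_comp hg hθ0 hu0 ((d : ℝ) / δ k)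
    have hXm : Measurable fun ω => θin k (m + 1) ω + δ k • u k ω :=
      ((hrun.measurable_inner hm hl hmτ.le).mono (hrun.info_le_ambient hmτ.le) le_rfl).add
        (hu0.const_smul (δ k))
    refine integrable_weight_mul (G := G) (c := w) hWm ((measurable_uncurry_loss hm hl).comp
      (hXm.prodMk (hrun.measurable_sample k (m + 1) hmτ))) ?_ (fun ω => hb _ _)
    filter_upwards [hrun.ae_norm_dir k] with ω hω
    rw [hw]
    exact abs_const_mul_inner_le (by positivity) hgK _ hω
  -- The descent lemma is applied once to the whole epoch, with the gradient at θ_k; the inner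
  -- product then splits into the weighted terms `V m`.
  have hpt : ∀ᵐ ω ∂P, Φ (θ (k + 1) ω) ≤ Φ (θ k ω)
      - η k * (∑ m ∈ Finset.range (τ k), lam ^ (τ k - (m + 1)) * V m ω)
      + w * (c / (1 - lam)) ^ 2 := by
    filter_upwards [hrun.ae_norm_dir k] with ω hω
    have h1 := hdesc (θ k ω) (θ (k + 1) ω)
    have h2 : ‖θ (k + 1) ω - θ k ω‖ ≤ c / (1 - lam) := by
      have h := hrun.norm_inner_sub_le hb hlam hlam' hη hδ hω (le_refl (τ k))
      rw [Nat.sub_self, pow_zero, ← hc, mul_one_div] at h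
      rw [hrun.next_param]
      exact h
    have h3 : inner ℝ (g (θ k ω)) (θ (k + 1) ω - θ k ω)
        = - (η k * ∑ m ∈ Finset.range (τ k), lam ^ (τ k - (m + 1)) * V m ω) := by
      have h4 := Finset.sum_range_sub (fun i => θin k (i + 1) ω) (τ k)
      rw [zero_add, hrun.start_param, ← hrun.next_param] at h4
      rw [← h4, inner_sum, Finset.mul_sum, ← Finset.sum_neg_distrib]
      refine Finset.sum_congr rfl fun i hi => ?_
      rw [hrun.inner_step k (Finset.mem_range.1 hi), inner_neg_right, real_inner_smul_right,
        real_inner_smul_right, hV]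
      ring
    have h5 : d / δ k * K * ‖θ (k + 1) ω - θ k ω‖ ^ 2 ≤ w * (c / (1 - lam)) ^ 2 := by
      rw [← hw]
      gcongr
    rw [h3] at h1
    linarith
  have hSi : Integrable (fun ω => ∑ m ∈ Finset.range (τ k), lam ^ (τ k - (m + 1)) * V m ω) P :=
    integrable_finsetSum _ fun m hmr => (hVi m hmr).const_mul _
  have hDi : Integrable (fun ω => Φ (θ k ω)
      - η k * ∑ m ∈ Finset.range (τ k), lam ^ (τ k - (m + 1)) * V m ω) P :=
    (hsi k).sub (hSi.const_mul (η k))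
  have hmono := integral_mono_ae (hsi (k + 1))
    (hDi.add (integrable_const (w * (c / (1 - lam)) ^ 2))) hpt
  simp only [Pi.add_apply] at hmono
  rw [integral_add hDi (integrable_const _),
    integral_sub (hsi k) (hSi.const_mul (η k)), integral_const_mul,
    integral_finsetSum _ (fun m hmr => (hVi m hmr).const_mul _)] at hmono
  simp only [integral_const_mul, integral_const, probReal_univ, one_smul] at hmono
  set N := ∫ ω, ‖g (θ k ω)‖ ^ 2 ∂P with hN
  have hN0 : 0 ≤ N := integral_nonneg fun ω => by positivity
  set b := w * (L₀ * (c / (1 - lam)) + 2 * G * (L₂ * (c / (1 - lam) / (1 - lam)))) with hbdef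
  have hb0 : 0 ≤ b := by positivity
  -- The forgetting weights sum to a number between 1 and 1/(1-λ). The lower bound is used for the
  -- squared gradient `N`, the upper bound for the bias `b`.
  have hlow : N - (b * (1 / (1 - lam))
      + w * (2 * G * M) * ∑ m ∈ Finset.range (τ k), lam ^ (τ k - (m + 1)) * ρ ^ (m + 1))
      ≤ ∑ m ∈ Finset.range (τ k), lam ^ (τ k - (m + 1)) * ∫ ω, V m ω ∂P := by
    have h1 : ∑ m ∈ Finset.range (τ k), lam ^ (τ k - (m + 1)) *
        (N - (b + w * (2 * G * M) * ρ ^ (m + 1)))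
        ≤ ∑ m ∈ Finset.range (τ k), lam ^ (τ k - (m + 1)) * ∫ ω, V m ω ∂P := by
      refine Finset.sum_le_sum fun m hmr => mul_le_mul_of_nonneg_left ?_ (pow_nonneg hlam _)
      have h := (abs_le.1 (hest m (Finset.mem_range.1 hmr))).1
      have hexp : b + w * (2 * G * M) * ρ ^ (m + 1) = w * (L₀ * (c / (1 - lam))) +
        w * (2 * G * (L₂ * (c / (1 - lam) / (1 - lam))) + 2 * G * (M * ρ ^ (m + 1))) := by
        rw [hbdef]
        ring
      rw [hexp]
      linarith
    have h2 : ∑ m ∈ Finset.range (τ k), lam ^ (τ k - (m + 1)) *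
        (N - (b + w * (2 * G * M) * ρ ^ (m + 1)))
        = (∑ m ∈ Finset.range (τ k), lam ^ (τ k - (m + 1))) * (N - b)
        - w * (2 * G * M) * ∑ m ∈ Finset.range (τ k), lam ^ (τ k - (m + 1)) * ρ ^ (m + 1) := by
      rw [Finset.mul_sum, Finset.sum_mul, ← Finset.sum_sub_distrib]
      exact Finset.sum_congr rfl fun m _ => by ring
    have h3 : ∑ m ∈ Finset.range (τ k), lam ^ (τ k - (m + 1)) ≤ 1 / (1 - lam) :=
      sum_pow_sub_le_inv hlam hlam' le_rfl
    -- The last inner step has weight λ⁰ = 1; it exists because the epoch is nonempty.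
    have h4 : 1 ≤ ∑ m ∈ Finset.range (τ k), lam ^ (τ k - (m + 1)) := by
      have h := Finset.single_le_sum (f := fun m => lam ^ (τ k - (m + 1)))
        (fun i _ => pow_nonneg hlam _) (Finset.mem_range.2 (by omega : τ k - 1 < τ k))
      simp only [show τ k - (τ k - 1 + 1) = 0 by omega, pow_zero] at h
      exact h
    have h5 := mul_le_mul_of_nonneg_right h3 hb0
    have h6 := mul_le_mul_of_nonneg_right h4 hN0
    rw [h2] at h1
    nlinarith
  have hfin := mul_le_mul_of_nonneg_left hlow hη.le
  rw [mul_sub] at hfin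
  linarith

end IsDFORun

/-! ### Elementary series and rates. -/

section Series

/-- Each of the n terms s^{n-i-1} of a geometric sum is at least s^n. -/
theorem mul_pow_le_inv_one_sub {s : ℝ} (h0 : 0 ≤ s) (h1 : s < 1) (n : ℕ) :
    n * s ^ n ≤ 1 / (1 - s) := by
  have h2 : ∑ _i ∈ Finset.range n, s ^ n ≤ ∑ i ∈ Finset.range n, s ^ (n - (i + 1)) :=
    Finset.sum_le_sum fun i _ => pow_le_pow_of_le_one h0 h1.le (by omega)
  rw [Finset.sum_const, Finset.card_range, nsmul_eq_mul] at h2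
  exact h2.trans (sum_pow_sub_le_inv h0 h1 le_rfl)

/-- The logarithmic lower bound on n gives r^n ≤ 1/x. Writing r^n as the square of √r^n, one factor
absorbs n and the other yields x^{-1/2}. -/
theorem mul_pow_le_of_log_le {r : ℝ} (h0 : 0 ≤ r) (h1 : r < 1) {n : ℕ} (hn : 1 ≤ n) {x : ℝ}
    (hx : 1 ≤ x) (h : Real.log x / Real.log (1 / r) ≤ n) :
    n * r ^ n ≤ 1 / (1 - √r) * x ^ (-(1 / 2) : ℝ) := by
  have hs1 : √r < 1 := by
    rw [Real.sqrt_lt' one_pos]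
    simpa using h1
  have hx0 : 0 < x := by linarith
  have hpow : r ^ n ≤ x⁻¹ := by
    -- For r = 0 the logarithmic hypothesis carries no information, and n ≥ 1 is what makes r^n
    -- vanish.
    rcases h0.eq_or_lt with rfl | hr
    · rw [zero_pow (by omega)]
      positivity
    · have hlog : 0 < Real.log (1 / r) := Real.log_pos (by rw [lt_div_iff₀ hr]; linarith)
      rw [div_le_iff₀ hlog, one_div, Real.log_inv] at h
      rw [← Real.log_le_log_iff (by positivity) (by positivity), Real.log_pow, Real.log_inv]
      linarith
  have hsq : √r ^ n ≤ x ^ (-(1 / 2) : ℝ) := by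
    have h2 : √r ^ n = √(r ^ n) := by
      rw [eq_comm, Real.sqrt_eq_iff_mul_self_eq (by positivity) (by positivity), ← mul_pow,
        Real.mul_self_sqrt h0]
    rw [h2, Real.rpow_neg hx0.le, ← Real.sqrt_eq_rpow, ← Real.sqrt_inv]
    exact Real.sqrt_le_sqrt hpow
  have h3 : (n : ℝ) * r ^ n = (n * √r ^ n) * √r ^ n := by
    rw [mul_assoc, ← mul_pow, Real.mul_self_sqrt h0]
  rw [h3]
  exact mul_le_mul (mul_pow_le_inv_one_sub (Real.sqrt_nonneg _) hs1 n) hsq (by positivity)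
    (div_nonneg zero_le_one (by linarith))

theorem sum_pow_mul_pow_le {lam ρ : ℝ} (hlam : 0 ≤ lam) (hρ : 0 ≤ ρ) (n : ℕ) :
    ∑ m ∈ Finset.range n, lam ^ (n - (m + 1)) * ρ ^ (m + 1) ≤ n * max ρ lam ^ n := by
  have h : ∀ m ∈ Finset.range n, lam ^ (n - (m + 1)) * ρ ^ (m + 1) ≤ max ρ lam ^ n := by
    intro m hm
    have hmn := Finset.mem_range.1 hm
    calc lam ^ (n - (m + 1)) * ρ ^ (m + 1)
        ≤ max ρ lam ^ (n - (m + 1)) * max ρ lam ^ (m + 1) := by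
          gcongr
          · exact le_max_right _ _
          · exact le_max_left _ _
      _ = max ρ lam ^ n := by
          rw [← pow_add]
          congr 1
          omega
  simpa using Finset.sum_le_sum h

/-- Bernoulli's inequality with exponent 1 - a ≤ 1 gives (x - 1)^{1-a} ≤ x^{1-a} - (1-a) x^{-a}, so
the sum telescopes. -/
theorem sum_rpow_neg_le {a : ℝ} (h0 : 0 ≤ a) (h1 : a < 1) (T : ℕ) :
    ∑ k ∈ Finset.range (T + 1), (1 + (k : ℝ)) ^ (-a)
      ≤ 1 / (1 - a) * (1 + (T : ℝ)) ^ (1 - a) := by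
  have ha : 0 < 1 - a := by linarith
  induction T with
  | zero =>
    simp only [zero_add, Finset.sum_range_one, Nat.cast_zero, add_zero, Real.one_rpow, mul_one]
    rw [le_div_iff₀ ha]
    linarith
  | succ T ih =>
    rw [Finset.sum_range_succ]
    have hx : (0 : ℝ) < 1 + ((T + 1 : ℕ) : ℝ) := by positivity
    have hy : (1 + (T : ℝ)) = (1 + ((T + 1 : ℕ) : ℝ)) * (1 + -(1 + ((T + 1 : ℕ) : ℝ))⁻¹) := by
      rw [mul_add, mul_neg, mul_inv_cancel₀ hx.ne']
      push_cast
      ring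
    have hinv : (1 + ((T + 1 : ℕ) : ℝ))⁻¹ ≤ 1 := inv_le_one_of_one_le₀ (by push_cast; linarith)
    have hb := rpow_one_add_le_one_add_mul_self (s := -(1 + ((T + 1 : ℕ) : ℝ))⁻¹)
      (p := 1 - a) (by linarith) ha.le (by linarith)
    have hT : (1 + (T : ℝ)) ^ (1 - a) ≤ (1 + ((T + 1 : ℕ) : ℝ)) ^ (1 - a)
        - (1 - a) * (1 + ((T + 1 : ℕ) : ℝ)) ^ (-a) := by
      have hsplit : (1 + ((T + 1 : ℕ) : ℝ)) ^ (-a)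
          = (1 + ((T + 1 : ℕ) : ℝ)) ^ (1 - a) * (1 + ((T + 1 : ℕ) : ℝ))⁻¹ := by
        rw [← Real.rpow_neg_one, ← Real.rpow_add hx]
        congr 1
        ring
      rw [hy, Real.mul_rpow hx.le (by linarith), hsplit]
      have := mul_le_mul_of_nonneg_left hb (Real.rpow_nonneg hx.le (1 - a))
      linarith
    have h2 := mul_le_mul_of_nonneg_left hT (one_div_nonneg.2 ha.le)
    have h3 : 1 / (1 - a) * ((1 + ((T + 1 : ℕ) : ℝ)) ^ (1 - a)
        - (1 - a) * (1 + ((T + 1 : ℕ) : ℝ)) ^ (-a))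
        = 1 / (1 - a) * (1 + ((T + 1 : ℕ) : ℝ)) ^ (1 - a) - (1 + ((T + 1 : ℕ) : ℝ)) ^ (-a) := by
      field_simp
    linarith

/-- Abel summation for a bounded sequence with monotone nonnegative weights. -/
theorem sum_mul_sub_le {p B : ℕ → ℝ} {R : ℝ} (hp : Monotone p) (hp0 : 0 ≤ p 0)
    (hB : ∀ k, B k ≤ R) (T : ℕ) :
    ∑ k ∈ Finset.range (T + 1), p k * (B k - B (k + 1)) ≤ p T * (R - B (T + 1)) := by
  induction T with
  | zero =>
    rw [zero_add, Finset.sum_range_one]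
    exact mul_le_mul_of_nonneg_left (by linarith [hB 0]) hp0
  | succ T ih =>
    rw [Finset.sum_range_succ]
    have h1 := mul_nonneg (sub_nonneg.2 (hp (Nat.le_succ T))) (sub_nonneg.2 (hB (T + 1)))
    simp only [Nat.succ_eq_add_one] at h1
    linarith

/-- Converts the rates T^{-1/4} and T^{-1/6} into thresholds of order ε^{-4} and μ^{-6}. -/
theorem mul_rpow_neg_inv_le {C ε : ℝ} (hC : 0 < C) (hε : 0 < ε) {n : ℕ} (hn : n ≠ 0) {T : ℝ}
    (hT : C ^ n / ε ^ n ≤ T) : C * (1 + T) ^ (-(1 / n) : ℝ) ≤ ε := by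
  have hCT : (C / ε) ^ n ≤ 1 + T := by
    rw [div_pow]
    linarith
  have hpos : 0 < 1 + T := lt_of_lt_of_le (by positivity) hCT
  have h1 : C / ε ≤ (1 + T) ^ (1 / n : ℝ) := by
    rw [one_div]
    rw [Real.le_rpow_inv_iff_of_pos (by positivity) hpos.le (by positivity), Real.rpow_natCast]
    exact hCT
  rw [Real.rpow_neg hpos.le, ← div_eq_mul_inv, div_le_iff₀ (by positivity)]
  rw [div_le_iff₀ hε] at h1
  linarith

theorem average_le_of_le {C a x s : ℝ} (hx : 0 < x) (h : s ≤ C * x ^ (1 - a)) :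
    1 / x * s ≤ C * x ^ (-a) := by
  have h2 : x ^ (1 - a) = x * x ^ (-a) := by
    rw [sub_eq_add_neg, Real.rpow_add hx, Real.rpow_one]
  rw [h2] at h
  rw [one_div, inv_mul_le_iff₀ hx]
  linarith

end Series

/-! ### Polynomial step sizes and radii. -/

section PolyDecay

theorem polyDecay_pos {c a : ℝ} (hc : 0 < c) (k : ℕ) : 0 < polyDecay c a k :=
  mul_pos hc (Real.rpow_pos_of_pos (by positivity) _)

theorem polyDecay_antitone {c a : ℝ} (hc : 0 ≤ c) (ha : 0 ≤ a) : Antitone (polyDecay c a) := by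
  intro k l hkl
  refine mul_le_mul_of_nonneg_left ?_ hc
  refine Real.rpow_le_rpow_of_nonpos (by positivity) ?_ (by linarith)
  have : (k : ℝ) ≤ l := by exact_mod_cast hkl
  linarith

theorem polyDecay_le {c a : ℝ} (hc : 0 ≤ c) (ha : 0 ≤ a) (k : ℕ) : polyDecay c a k ≤ c := by
  have h := polyDecay_antitone hc ha (Nat.zero_le k)
  simpa [polyDecay] using h

end PolyDecay

/-! ### The descent inequality with the chosen exponents. -/

namespace IsDFORun

variable {d : ℕ} {S Ω : Type*} [MeasurableSpace S] [mΩ : MeasurableSpace Ω]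
  {loss : Param d → S → ℝ} {ker : Param d → Kernel S S} {statDist : Param d → Measure S}
  {G L₀ L₁ L₂ M ρ : ℝ} {lam η₀ : ℝ} {τ : ℕ → ℕ}
  {P : Measure Ω} [IsProbabilityMeasure P] [∀ θ, IsMarkovKernel (ker θ)]
  [∀ θ, IsProbabilityMeasure (statDist θ)]
  {θ : ℕ → Ω → Param d} {Z : ℕ → Ω → S} {u : ℕ → Ω → Param d}
  {θin : ℕ → ℕ → Ω → Param d} {Zin : ℕ → ℕ → Ω → S}

/-- The mean squared gradient at epoch `k` is a weighted increment plus `O((1 + k)^{-1/4})`. -/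
theorem integral_norm_gradient_sq_le
    (hrun : IsDFORun loss ker lam (polyDecay η₀ (3 / 4)) (polyDecay (d : ℝ) (1 / 6)) τ
      P θ Z u θin Zin) (hd : 1 ≤ d) (hη₀ : 0 < η₀) (hlam : 0 ≤ lam)
    (hlam' : lam < 1) (hρ : 0 ≤ ρ) (hρ' : ρ < 1) (hM : 0 ≤ M) (hG : 0 ≤ G) (hL₀ : 0 ≤ L₀)
    (hL₁ : 0 ≤ L₁) (hL₂ : 0 ≤ L₂)
    (hm : ∀ θ, Measurable (loss θ)) (hl : LipschitzLoss L₀ loss) (hb : BoundedLoss G loss)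
    (hdist : LipschitzDistMap L₁ statDist) (hmix : GeometricMixing M ρ ker statDist)
    (hk : LipschitzKernel L₂ ker) {k : ℕ} (hτ : 1 ≤ τ k)
    (hτlog : Real.log (1 + (k : ℝ)) / Real.log (1 / max ρ lam) ≤ (τ k : ℝ)) {K : ℝ}
    (hK : K = L₀ + 2 * G * L₁) :
    ∫ ω, ‖∇ (smoothed (perfRisk loss statDist) (polyDecay (d : ℝ) (1 / 6) k)) (θ k ω)‖ ^ 2 ∂P
      ≤ (polyDecay η₀ (3 / 4) k)⁻¹ *
        (((∫ ω, smoothed (perfRisk loss statDist) (polyDecay (d : ℝ) (1 / 6) k) (θ k ω) ∂P)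
            + K * polyDecay (d : ℝ) (1 / 6) k)
          - ((∫ ω, smoothed (perfRisk loss statDist) (polyDecay (d : ℝ) (1 / 6) (k + 1))
              (θ (k + 1) ω) ∂P) + K * polyDecay (d : ℝ) (1 / 6) (k + 1)))
        + (K * η₀ * G * ((L₀ * (1 / (1 - lam)) + 2 * G * (L₂ * (1 / (1 - lam) / (1 - lam))))
              * (1 / (1 - lam)))
            + K * (2 * G * M) * (1 / (1 - √(max ρ lam)))
            + K * η₀ * G ^ 2 * (1 / (1 - lam)) ^ 2) * (1 + (k : ℝ)) ^ (-(1 / 4) : ℝ) := by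
  have hK0 : 0 ≤ K := by rw [hK]; positivity
  have hd0 : (0 : ℝ) < d := by exact_mod_cast hd
  have hη := polyDecay_pos (a := 3 / 4) hη₀ k
  have hδ := polyDecay_pos (a := 1 / 6) hd0 k
  have hlam1 : 0 < 1 - lam := by linarith
  have hr1 : max ρ lam < 1 := max_lt hρ' hlam'
  have hsr : 0 < 1 - √(max ρ lam) := by
    have : √(max ρ lam) < 1 := by
      rw [Real.sqrt_lt' one_pos]
      simpa using hr1
    linarith
  have hmain := hrun.epoch_descent hd hlam hlam' hG hL₀ hL₁ hL₂ hm hl hb hdist hmix hk hη hδ hτ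
    hK rfl rfl
  have hF : ∀ x y, |perfRisk loss statDist x - perfRisk loss statDist y| ≤ K * ‖x - y‖ :=
    hK ▸ abs_perfRisk_sub_le hm hG hl hb hdist
  have hFc := continuous_of_abs_sub_le hF
  have hsi := fun (δ : ℝ) => hrun.integrable_comp_param (P := P) hm hl
    (continuous_of_abs_sub_le (abs_smoothed_sub_le (δ := δ) hF))
    (abs_smoothed_le hFc (abs_perfRisk_le hb)) (k + 1)
  -- Shrinking the radius costs K(δ_k - δ_{k+1}). This telescopes, which is why Kδ_k is added to the
  -- potential.
  have hdrift : (∫ ω, smoothed (perfRisk loss statDist) (polyDecay (d : ℝ) (1 / 6) (k + 1))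
      (θ (k + 1) ω) ∂P) ≤
      (∫ ω, smoothed (perfRisk loss statDist) (polyDecay (d : ℝ) (1 / 6) k) (θ (k + 1) ω) ∂P)
      + K * (polyDecay (d : ℝ) (1 / 6) k - polyDecay (d : ℝ) (1 / 6) (k + 1)) := by
    have hmono : polyDecay (d : ℝ) (1 / 6) (k + 1) ≤ polyDecay (d : ℝ) (1 / 6) k :=
      polyDecay_antitone hd0.le (by norm_num) (Nat.le_succ k)
    have h := integral_mono (hsi (polyDecay (d : ℝ) (1 / 6) (k + 1)))
      ((hsi (polyDecay (d : ℝ) (1 / 6) k)).add (integrable_const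
        (K * (polyDecay (d : ℝ) (1 / 6) k - polyDecay (d : ℝ) (1 / 6) (k + 1))))) fun ω => by
      have h1 := (abs_le.1 (abs_smoothed_sub_radius_le hK0 hF (polyDecay (d : ℝ) (1 / 6) k)
        (polyDecay (d : ℝ) (1 / 6) (k + 1)) (θ (k + 1) ω))).1
      rw [abs_of_nonneg (sub_nonneg.2 hmono)] at h1
      simp only [Pi.add_apply]
      linarith
    simp only [Pi.add_apply] at h
    rw [integral_add (hsi _) (integrable_const _)] at h
    simpa using h
  have hx0 : (0 : ℝ) < 1 + (k : ℝ) := by positivity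
  have hx1 : (1 : ℝ) ≤ 1 + (k : ℝ) := by simp
  have hsum := (sum_pow_mul_pow_le hlam hρ (τ k)).trans
    (mul_pow_le_of_log_le (le_max_of_le_right hlam) hr1 hτ hx1 hτlog)
  -- All exponents are multiples of 1/12: δ_k = d z², η_k = η₀ z⁹, and the target rate is z³. After
  -- division by η_k, the drift bias is of order z⁵, the mixing bias z⁴ and the second-order term
  -- z³, which decides the rate.
  obtain ⟨z, hz⟩ : ∃ z, z = (1 + (k : ℝ)) ^ (-(1 / 12) : ℝ) := ⟨_, rfl⟩
  have hz0 : 0 < z := hz ▸ Real.rpow_pos_of_pos hx0 _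
  have hz1 : z ≤ 1 := hz ▸ Real.rpow_le_one_of_one_le_of_nonpos hx1 (by norm_num)
  have hzpow : ∀ n : ℕ, (1 + (k : ℝ)) ^ (-(n / 12) : ℝ) = z ^ n := by
    intro n
    rw [hz, ← Real.rpow_natCast, ← Real.rpow_mul hx0.le]
    congr 1
    ring
  have e4 : (1 + (k : ℝ)) ^ (-(1 / 4) : ℝ) = z ^ 3 := by
    rw [← hzpow]
    norm_num
  have e2 : (1 + (k : ℝ)) ^ (-(1 / 2) : ℝ) = z ^ 6 := by
    rw [← hzpow]
    norm_num
  have eδ : polyDecay (d : ℝ) (1 / 6) k = d * z ^ 2 := by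
    rw [polyDecay, ← hzpow]
    norm_num
  have eη : polyDecay η₀ (3 / 4) k = η₀ * z ^ 9 := by
    rw [polyDecay, ← hzpow]
    norm_num
  have edδ : (d : ℝ) / polyDecay (d : ℝ) (1 / 6) k = (z ^ 2)⁻¹ := by
    rw [eδ]
    field_simp
  rw [edδ] at hmain
  rw [e2] at hsum
  rw [e4]
  set η := polyDecay η₀ (3 / 4) k with hηdef
  set s := ∑ m ∈ Finset.range (τ k), lam ^ (τ k - (m + 1)) * ρ ^ (m + 1)
  have t1 : (z ^ 2)⁻¹ * K * (L₀ * (η * ((z ^ 2)⁻¹ * G) / (1 - lam))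
      + 2 * G * (L₂ * (η * ((z ^ 2)⁻¹ * G) / (1 - lam) / (1 - lam)))) * (1 / (1 - lam))
      ≤ K * η₀ * G * ((L₀ * (1 / (1 - lam)) + 2 * G * (L₂ * (1 / (1 - lam) / (1 - lam))))
              * (1 / (1 - lam))) * z ^ 3 := by
    have h1 : (z ^ 2)⁻¹ * K * (L₀ * (η * ((z ^ 2)⁻¹ * G) / (1 - lam))
      + 2 * G * (L₂ * (η * ((z ^ 2)⁻¹ * G) / (1 - lam) / (1 - lam)))) * (1 / (1 - lam))
      = K * η₀ * G * ((L₀ * (1 / (1 - lam)) + 2 * G * (L₂ * (1 / (1 - lam) / (1 - lam))))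
              * (1 / (1 - lam))) * z ^ 5 := by
      rw [eη]
      field_simp
    rw [h1]
    exact mul_le_mul_of_nonneg_left (pow_le_pow_of_le_one hz0.le hz1 (by norm_num))
      (by positivity)
  have t2 : (z ^ 2)⁻¹ * K * (2 * G * M) * s
      ≤ K * (2 * G * M) * (1 / (1 - √(max ρ lam))) * z ^ 3 := by
    calc (z ^ 2)⁻¹ * K * (2 * G * M) * s
        ≤ (z ^ 2)⁻¹ * K * (2 * G * M) * (1 / (1 - √(max ρ lam)) * z ^ 6) :=
          mul_le_mul_of_nonneg_left hsum (by positivity)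
      _ = K * (2 * G * M) * (1 / (1 - √(max ρ lam))) * z ^ 4 := by
          field_simp
      _ ≤ _ := mul_le_mul_of_nonneg_left (pow_le_pow_of_le_one hz0.le hz1 (by norm_num))
          (by positivity)
  have t3 : (z ^ 2)⁻¹ * K * (η * ((z ^ 2)⁻¹ * G) / (1 - lam)) ^ 2
      = η * (K * η₀ * G ^ 2 * (1 / (1 - lam)) ^ 2 * z ^ 3) := by
    rw [eη]
    field_simp
  rw [t3] at hmain
  have t12 := mul_le_mul_of_nonneg_left (add_le_add t1 t2) hη.le
  rw [← sub_le_iff_le_add, inv_mul_eq_div, le_div_iff₀ hη]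
  linarith

end IsDFORun
-- Summation over epochs.
theorem mainTheorem4
    (d : ℕ) (hd : 1 ≤ d)
    (η₀ lam ρ M G L₀ L₁ L₂ : ℝ)
    (hη₀ : 0 < η₀) (hlam : 0 ≤ lam) (hlam' : lam < 1) (hρ : 0 ≤ ρ) (hρ' : ρ < 1)
    (hM : 0 ≤ M) (hG : 0 < G) (hL₀ : 0 < L₀) (hL₁ : 0 < L₁) (hL₂ : 0 ≤ L₂) :
    ∃ C₁ C₂ : ℝ, 0 < C₁ ∧ 0 < C₂ ∧
      ∀ (S : Type*) [MeasurableSpace S]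
        (loss : Param d → S → ℝ) (ker : Param d → Kernel S S) (statDist : Param d → Measure S),
        (∀ θ, Measurable (loss θ)) →
        (∀ θ, IsMarkovKernel (ker θ)) →
        (∀ θ, IsProbabilityMeasure (statDist θ)) →
        (∀ θ, (ker θ).Invariant (statDist θ)) →
        LipschitzLoss L₀ loss →
        BoundedLoss G loss →
        LipschitzDistMap L₁ statDist →
        GeometricMixing M ρ ker statDist →
        LipschitzKernel L₂ ker →
      ∀ τ : ℕ → ℕ,
        (∀ k, 1 ≤ τ k) →
        (∀ k : ℕ, Real.log (1 + (k : ℝ)) / Real.log (1 / max ρ lam) ≤ (τ k : ℝ)) →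
      ∀ (Ω : Type*) [MeasurableSpace Ω] (P : Measure Ω) [IsProbabilityMeasure P]
        (θ : ℕ → Ω → Param d) (Z : ℕ → Ω → S) (u : ℕ → Ω → Param d)
        (θin : ℕ → ℕ → Ω → Param d) (Zin : ℕ → ℕ → Ω → S),
        IsDFORun loss ker lam (polyDecay η₀ (3 / 4)) (polyDecay (d : ℝ) (1 / 6)) τ
          P θ Z u θin Zin →
        (∀ k : ℕ,
          Differentiable ℝ (smoothed (perfRisk loss statDist) (polyDecay (d : ℝ) (1 / 6) k)) ∧
          Integrable (fun ω =>
            ‖∇ (smoothed (perfRisk loss statDist) (polyDecay (d : ℝ) (1 / 6) k)) (θ k ω)‖ ^ 2) P ∧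
          Integrable (fun ω =>
            |smoothed (perfRisk loss statDist) (polyDecay (d : ℝ) (1 / 6) k) (θ k ω)
              - perfRisk loss statDist (θ k ω)|) P) ∧
        ∀ ε μ : ℝ, 0 < ε → 0 < μ →
        ∀ T : ℕ, max (C₁ / ε ^ 4) (C₂ / μ ^ 6) ≤ (T : ℝ) →
          1 / (1 + (T : ℝ)) * ∑ k ∈ Finset.range (T + 1),
            ∫ ω, ‖∇ (smoothed (perfRisk loss statDist) (polyDecay (d : ℝ) (1 / 6) k))
              (θ k ω)‖ ^ 2 ∂P ≤ ε ∧
          1 / (1 + (T : ℝ)) * ∑ k ∈ Finset.range (T + 1),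
            ∫ ω, |smoothed (perfRisk loss statDist) (polyDecay (d : ℝ) (1 / 6) k) (θ k ω)
              - perfRisk loss statDist (θ k ω)| ∂P ≤ μ := by
  have hd0 : (0 : ℝ) < d := by exact_mod_cast hd
  have hlam1 : 0 < 1 - lam := by linarith
  have hr1 : max ρ lam < 1 := max_lt hρ' hlam'
  have hsr : 0 < 1 - √(max ρ lam) := by
    have : √(max ρ lam) < 1 := by
      rw [Real.sqrt_lt' one_pos]
      simpa using hr1
    linarith
  obtain ⟨K, hK⟩ : ∃ K, K = L₀ + 2 * G * L₁ := ⟨_, rfl⟩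
  have hK0 : 0 < K := by rw [hK]; positivity
  obtain ⟨C, hC⟩ : ∃ C, C = K * η₀ * G * ((L₀ * (1 / (1 - lam))
      + 2 * G * (L₂ * (1 / (1 - lam) / (1 - lam)))) * (1 / (1 - lam)))
      + K * (2 * G * M) * (1 / (1 - √(max ρ lam))) + K * η₀ * G ^ 2 * (1 / (1 - lam)) ^ 2 :=
    ⟨_, rfl⟩
  have hC0 : 0 ≤ C := by rw [hC]; positivity
  -- The potential lies in [-G, G + Kd], whence 2G + Kd after Abel summation; 4/3 is 1/(1 - 1/4)
  -- from summing (1+k)^{-1/4}. In the same way 6/5 in `D₂` is 1/(1 - 1/6).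
  obtain ⟨D₁, hD₁⟩ : ∃ D₁, D₁ = (2 * G + K * d) / η₀ + 4 / 3 * C := ⟨_, rfl⟩
  have hD₁0 : 0 < D₁ := by rw [hD₁]; positivity
  obtain ⟨D₂, hD₂⟩ : ∃ D₂, D₂ = 6 / 5 * (K * d) := ⟨_, rfl⟩
  have hD₂0 : 0 < D₂ := by rw [hD₂]; positivity
  refine ⟨D₁ ^ 4, D₂ ^ 6, by positivity, by positivity, ?_⟩
  intro S _ loss ker statDist hm hker hstat _ hl hb hdist hmix hk τ hτ hτlog Ω _ P _ θ Z u θin Zin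
    hrun
  have hF : ∀ x y, |perfRisk loss statDist x - perfRisk loss statDist y| ≤ K * ‖x - y‖ :=
    hK ▸ abs_perfRisk_sub_le hm hG.le hl hb hdist
  have hFc := continuous_of_abs_sub_le hF
  have hFG := abs_perfRisk_le (statDist := statDist) hb
  have hδ : ∀ k, 0 < polyDecay (d : ℝ) (1 / 6) k := polyDecay_pos hd0
  have hsc : ∀ k, Continuous
      (smoothed (perfRisk loss statDist) (polyDecay (d : ℝ) (1 / 6) k)) := fun k =>
    continuous_of_abs_sub_le (abs_smoothed_sub_le hF)
  have hgap : ∀ k x, |smoothed (perfRisk loss statDist) (polyDecay (d : ℝ) (1 / 6) k) x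
      - perfRisk loss statDist x| ≤ K * polyDecay (d : ℝ) (1 / 6) k := fun k x =>
    abs_smoothed_sub_self_le hK0.le hF (hδ k).le x
  have hgi : ∀ k, Integrable (fun ω =>
      |smoothed (perfRisk loss statDist) (polyDecay (d : ℝ) (1 / 6) k) (θ k ω)
        - perfRisk loss statDist (θ k ω)|) P := fun k =>
    hrun.integrable_comp_param hm hl ((hsc k).sub hFc).abs
      (fun x => by rw [abs_abs]; exact hgap k x) k
  refine ⟨fun k => ⟨fun x => (hasGradientAt_smoothed hK0.le hF hd (hδ k) x).differentiableAt,
    hrun.integrable_comp_param hm hl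
      ((lipschitzWith_gradient_smoothed hK0.le hF hd (hδ k)).continuous.norm.pow 2)
      (B := K ^ 2) (fun x => ?_) k, hgi k⟩, ?_⟩
  · rw [abs_of_nonneg (sq_nonneg _)]
    exact pow_le_pow_left₀ (norm_nonneg _) (norm_gradient_smoothed_le hK0.le hF hd (hδ k) x) 2
  intro ε μ hε hμ T hT
  have hxT : (0 : ℝ) < 1 + (T : ℝ) := by positivity
  constructor
  · set B : ℕ → ℝ := fun k =>
      (∫ ω, smoothed (perfRisk loss statDist) (polyDecay (d : ℝ) (1 / 6) k) (θ k ω) ∂P)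
        + K * polyDecay (d : ℝ) (1 / 6) k with hB
    have hA : ∀ k,
        |∫ ω, smoothed (perfRisk loss statDist) (polyDecay (d : ℝ) (1 / 6) k) (θ k ω) ∂P| ≤ G :=
      fun k => abs_integral_le_of_abs_le fun ω => abs_smoothed_le hFc hFG _
    have hBR : ∀ k, B k ≤ G + K * d := fun k =>
      add_le_add (abs_le.1 (hA k)).2
        (mul_le_mul_of_nonneg_left (polyDecay_le hd0.le (by norm_num) k) hK0.le)
    have hBlow : ∀ k, -G ≤ B k := fun k => by
      have h1 := (abs_le.1 (hA k)).1
      have h2 := mul_nonneg hK0.le (hδ k).le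
      simp only [hB]
      linarith
    have hp : Monotone fun k => (polyDecay η₀ (3 / 4) k)⁻¹ := fun k l hkl =>
      inv_anti₀ (polyDecay_pos hη₀ l) (polyDecay_antitone hη₀.le (by norm_num) hkl)
    -- The weights 1/η_k increase, so the weighted increments of the potential are controlled by the
    -- last weight, which is (1+T)^{3/4}/η₀.
    have habel := sum_mul_sub_le hp (inv_nonneg.2 (polyDecay_pos hη₀ 0).le) hBR T
    have hpT : (polyDecay η₀ (3 / 4) T)⁻¹ = 1 / η₀ * (1 + (T : ℝ)) ^ (1 - 1 / 4 : ℝ) := by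
      rw [polyDecay, mul_inv, ← Real.rpow_neg hxT.le]
      norm_num
    have habel' : (polyDecay η₀ (3 / 4) T)⁻¹ * (G + K * d - B (T + 1))
        ≤ (2 * G + K * d) / η₀ * (1 + (T : ℝ)) ^ (1 - 1 / 4 : ℝ) := by
      rw [hpT]
      calc _ ≤ 1 / η₀ * (1 + (T : ℝ)) ^ (1 - 1 / 4 : ℝ) * (2 * G + K * d) :=
            mul_le_mul_of_nonneg_left (by linarith [hBlow (T + 1)]) (by positivity)
        _ = _ := by ring
    have hser := mul_le_mul_of_nonneg_left
      (sum_rpow_neg_le (a := 1 / 4) (by norm_num) (by norm_num) T) hC0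
    have hsum : ∑ k ∈ Finset.range (T + 1), ∫ ω, ‖∇ (smoothed (perfRisk loss statDist)
        (polyDecay (d : ℝ) (1 / 6) k)) (θ k ω)‖ ^ 2 ∂P
        ≤ D₁ * (1 + (T : ℝ)) ^ (1 - 1 / 4 : ℝ) := by
      have h1 := Finset.sum_le_sum fun k (_ : k ∈ Finset.range (T + 1)) =>
        hrun.integral_norm_gradient_sq_le hd hη₀ hlam hlam' hρ hρ' hM hG.le hL₀.le hL₁.le hL₂
          hm hl hb hdist hmix hk (hτ k) (hτlog k) hK
      rw [← hC, Finset.sum_add_distrib, ← Finset.mul_sum] at h1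
      refine h1.trans ((add_le_add (habel.trans habel') hser).trans_eq ?_)
      rw [hD₁]
      norm_num
      ring
    refine (average_le_of_le hxT hsum).trans ?_
    exact_mod_cast mul_rpow_neg_inv_le hD₁0 hε (n := 4) (by norm_num)
      ((le_max_left _ _).trans hT)
  · have hser := mul_le_mul_of_nonneg_left
      (sum_rpow_neg_le (a := 1 / 6) (by norm_num) (by norm_num) T) (mul_nonneg hK0.le hd0.le)
    have hsum : ∑ k ∈ Finset.range (T + 1),
        ∫ ω, |smoothed (perfRisk loss statDist) (polyDecay (d : ℝ) (1 / 6) k) (θ k ω)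
          - perfRisk loss statDist (θ k ω)| ∂P ≤ D₂ * (1 + (T : ℝ)) ^ (1 - 1 / 6 : ℝ) := by
      have h1 : ∀ k ∈ Finset.range (T + 1),
          ∫ ω, |smoothed (perfRisk loss statDist) (polyDecay (d : ℝ) (1 / 6) k) (θ k ω)
            - perfRisk loss statDist (θ k ω)| ∂P ≤ K * d * (1 + (k : ℝ)) ^ (-(1 / 6) : ℝ) := by
        intro k _
        have h2 := integral_mono (hgi k) (integrable_const (K * polyDecay (d : ℝ) (1 / 6) k))
          fun ω => hgap k (θ k ω)
        rw [integral_const, probReal_univ, one_smul, polyDecay, ← mul_assoc] at h2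
        exact h2
      refine (Finset.sum_le_sum h1).trans ?_
      rw [← Finset.mul_sum]
      refine hser.trans_eq ?_
      rw [hD₂]
      norm_num
      ring
    refine (average_le_of_le hxT hsum).trans ?_
    exact_mod_cast mul_rpow_neg_inv_le hD₂0 hμ (n := 6) (by norm_num)
      ((le_max_right _ _).trans hT)
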